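/- Let $n\ge 0$ be an integer and $[-n;n]=\{-n,\dots,-1,1,\dots,n\}$. Let $J$ be the $2n\times 2n$ matrix, with rows and columns indexed by $[-n;n]$, with ones on the anti-diagonal and zeros elsewhere, and let $\mathfrak o_{2n}=\{X\in M_{2n}(\mathbb C): X^TJ+JX=0\}$. Put $F_{ij}=E_{ij}-E_{-j,-i}$ for $i,j\in[-n;n]$, and let $\mathfrak h\subset\mathfrak o_{2n}$ be the Cartan subalgebra generated by the $F_{ii}$. For $X\in\mathfrak o_{2n}$ write $X[r]=Xt^r$, and let $U=U(t^{-1}\mathfrak o_{2n}[t^{-1}])$ be the universal enveloping algebra of the Lie algebra spanned by the $X[r]$, $r<0$, with $[X[r],Y[s]]=[X,Y][r+s]$. Let $U^{\mathfrak h}$ be the subalgebra of invariants of $U$ under the adjoint action of $\mathfrak h$ (where $H\in\mathfrak h$ acts by the derivation $X[r]\mapsto [H,X][r]$), and let $I$ be the left ideal of $U$ generated by the elements $F_{ij}[r]$ with $-n\le i<j\le n$ and $r<0$. Let $\mathrm{ad}_\tau$ be the derivation of $U(t^{-1}\mathfrak h[t^{-1}])$ with $\mathrm{ad}_\tau(H[r])=-r\,H[r-1]$,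 and write $\mu_i[r]=F_{ii}[r]\in U(t^{-1}\mathfrak h[t^{-1}])$ for $i=-n,\dots,-1$, $r<0$. Finally let $\tilde F[-1]=F[-1]J$ with $F[-1]=(F_{ij}[-1])_{i,j\in[-n;n]}$, and let $$\operatorname{Pf}\tilde F[-1]=\frac1{2^n n!}\sum_{\sigma}\operatorname{sgn}(\sigma)\,\tilde F_{\sigma(-n),\sigma(-n+1)}[-1]\cdots\tilde F_{\sigma(n-1),\sigma(n)}[-1]\in U,$$ the sum being over all permutations $\sigma$ of $[-n;n]$. Then there is a unique algebra homomorphism (the Harish-Chandra homomorphism) $$\chi: U^{\mathfrak h}\to U(t^{-1}\mathfrak h[t^{-1}])$$ whose kernel is $U^{\mathfrak h}\cap I$ and which is the identity on $U(t^{-1}\mathfrak h[t^{-1}])$, that is, $\chi$ maps the image in $U^{\mathfrak h}$ of each $p\in U(t^{-1}\mathfrak h[t^{-1}])$ to $p$. The Pfaffian $\operatorname{Pf}\tilde F[-1]$ belongs to $U^{\mathfrak h}$, and $$\chi(\operatorname{Pf}\tilde F[-1])=(\mu_{-n}[-1]+\mathrm{ad}_\tau)\cdots(\mu_{-1}[-1]+\mathrm{ad}_\tau)\cdot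 1,$$ where $\mu_i[-1]$ acts on $U(t^{-1}\mathfrak h[t^{-1}])$ by multiplication. -/

import Mathlib

attribute [local instance 100] LieRing.ofAssociativeRing

open scoped TensorProduct

noncomputable section

namespace AffinePfaffian

/-! ### The Lie algebra `t⁻¹ g[t⁻¹]` and its derivations -/

section Loop

variable (g : Type*) [LieRing g] [LieAlgebra ℂ g]

/-- The loop algebra `g[t, t⁻¹]`. -/
def Loop := LieAlgebra.loopAlgebra ℂ ℤ g

instance : LieRing (Loop g) := inferInstanceAs (LieRing (LieAlgebra.loopAlgebra ℂ ℤ g))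

instance : LieAlgebra ℂ (Loop g) :=
  inferInstanceAs (LieAlgebra ℂ (LieAlgebra.loopAlgebra ℂ ℤ g))

variable {g} in
/-- The element `x[r] = x tʳ` of the loop algebra. -/
def loopElt (x : g) (r : ℤ) : Loop g :=
  (AddMonoidAlgebra.single r (1 : ℂ) ⊗ₜ[ℂ] x : AddMonoidAlgebra ℂ ℤ ⊗[ℂ] g)

theorem loopElt_zero (r : ℤ) : loopElt (0 : g) r = 0 :=
  TensorProduct.tmul_zero _ _

theorem loopElt_neg (x : g) (r : ℤ) : loopElt (-x) r = -loopElt x r :=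
  TensorProduct.tmul_neg _ _

theorem lie_loopElt (x y : g) (r s : ℤ) :
    ⁅loopElt x r, loopElt y s⁆ = loopElt ⁅x, y⁆ (r + s) := by
  have h := LieAlgebra.ExtendScalars.bracket_tmul ℂ (AddMonoidAlgebra ℂ ℤ) g g
    (AddMonoidAlgebra.single r (1 : ℂ)) (AddMonoidAlgebra.single s (1 : ℂ)) x y
  rw [AddMonoidAlgebra.single_mul_single, one_mul] at h
  exact h

/-- The Lie subalgebra `t⁻¹ g[t⁻¹]` of `g[t, t⁻¹]`, spanned by the `x[r]` with `r < 0`. (The central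
term `r δ_{r,-s} ⟨x, y⟩ K` of the affine bracket `⁅x[r], y[s]⁆` vanishes for `r, s < 0`, so this is
also a Lie subalgebra of the affine Kac-Moody algebra.) -/
def negLoop : LieSubalgebra ℂ (Loop g) where
  __ := Submodule.span ℂ {z : Loop g | ∃ (x : g) (r : ℤ), r < 0 ∧ z = loopElt x r}
  lie_mem' := by
    intro a b ha hb
    simp only [AddSubsemigroup.mem_carrier, AddSubmonoid.mem_toSubsemigroup,
      Submodule.mem_toAddSubmonoid] at ha hb ⊢
    induction ha, hb using Submodule.span_induction₂ with
    | mem_mem a b ha hb =>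
      obtain ⟨x, r, hr, rfl⟩ := ha
      obtain ⟨y, s, hs, rfl⟩ := hb
      rw [lie_loopElt]
      exact Submodule.subset_span ⟨_, _, by omega, rfl⟩
    | zero_left => simp
    | zero_right => simp
    | add_left a b c _ _ _ h1 h2 => rw [add_lie]; exact add_mem h1 h2
    | add_right a b c _ _ _ h1 h2 => rw [lie_add]; exact add_mem h1 h2
    | smul_left c a b _ _ h => rw [smul_lie]; exact Submodule.smul_mem _ _ h
    | smul_right c a b _ _ h => rw [lie_smul]; exact Submodule.smul_mem _ _ h

variable {g} in
/-- The element `x[r]`, `r < 0`, of `t⁻¹ g[t⁻¹]`. -/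
def negElt (x : g) (r : ℤ) (hr : r < 0) : negLoop g :=
  ⟨loopElt x r, Submodule.subset_span ⟨x, r, hr, rfl⟩⟩

variable {g} in
theorem negLoop_induction {p : Loop g → Prop}
    (helt : ∀ (x : g) (r : ℤ), r < 0 → p (loopElt x r))
    (hzero : p 0) (hadd : ∀ a b, p a → p b → p (a + b)) (hsmul : ∀ (c : ℂ) a, p a → p (c • a))
    (z : negLoop g) : p z := by
  obtain ⟨z, hz⟩ := z
  change z ∈ Submodule.span ℂ _ at hz
  induction hz using Submodule.span_induction with
  | mem a ha => obtain ⟨x, r, hr, rfl⟩ := ha; exact helt x r hr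
  | zero => exact hzero
  | add a b _ _ h1 h2 => exact hadd a b h1 h2
  | smul c a _ h => exact hsmul c a h

/-- The linear map `-d/dt : tʳ ↦ -r tʳ⁻¹` on Laurent polynomials. -/
def negDeriv : AddMonoidAlgebra ℂ ℤ →ₗ[ℂ] AddMonoidAlgebra ℂ ℤ :=
  (AddMonoidAlgebra.basis ℤ ℂ).constr ℂ
    (fun r : ℤ => AddMonoidAlgebra.single (r - 1) (-(r : ℂ)))

/-- The operator `[τ, ·] = -d/dt` on the loop algebra: `x[r] ↦ -r x[r - 1]`. -/
def loopTau : Loop g →ₗ[ℂ] Loop g :=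
  (LinearMap.rTensor g negDeriv :
    AddMonoidAlgebra ℂ ℤ ⊗[ℂ] g →ₗ[ℂ] AddMonoidAlgebra ℂ ℤ ⊗[ℂ] g)

theorem loopTau_loopElt (x : g) (r : ℤ) :
    loopTau g (loopElt x r) = (-(r : ℂ)) • loopElt x (r - 1) := by
  have h : negDeriv (AddMonoidAlgebra.single r (1 : ℂ)) =
      (-(r : ℂ)) • AddMonoidAlgebra.single (r - 1) (1 : ℂ) := by
    rw [← AddMonoidAlgebra.basis_apply, negDeriv, Module.Basis.constr_basis,
      AddMonoidAlgebra.smul_single, smul_eq_mul, mul_one]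
  change negDeriv (AddMonoidAlgebra.single r (1 : ℂ)) ⊗ₜ[ℂ] x = _
  rw [h]
  rfl

/-- The restriction of `[τ, ·]` to a derivation of `t⁻¹ g[t⁻¹]`. -/
def tauDer : LieDerivation ℂ (negLoop g) (negLoop g) where
  toLinearMap := (loopTau g).restrict (p := (negLoop g).toSubmodule)
    (q := (negLoop g).toSubmodule) (by
      intro z hz
      refine negLoop_induction (p := fun z => loopTau g z ∈ (negLoop g).toSubmodule)
        ?_ ?_ ?_ ?_ ⟨z, hz⟩
      · intro x r hr
        rw [loopTau_loopElt]
        exact Submodule.smul_mem _ _ (Submodule.subset_span ⟨x, r - 1, by omega, rfl⟩)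
      · simp
      · intro a b ha hb; rw [map_add]; exact add_mem ha hb
      · intro c a ha; rw [map_smul]; exact Submodule.smul_mem _ _ ha)
  leibniz' := by
    intro a b
    apply Subtype.ext
    change loopTau g ⁅(a : Loop g), (b : Loop g)⁆ =
      ⁅(a : Loop g), loopTau g b⁆ - ⁅(b : Loop g), loopTau g a⁆
    refine negLoop_induction (p := fun a => loopTau g ⁅a, (b : Loop g)⁆ =
      ⁅a, loopTau g b⁆ - ⁅(b : Loop g), loopTau g a⁆) ?_ ?_ ?_ ?_ a
    · intro x r hr
      refine negLoop_induction (p := fun b => loopTau g ⁅loopElt x r, b⁆ =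
        ⁅loopElt x r, loopTau g b⁆ - ⁅b, loopTau g (loopElt x r)⁆) ?_ ?_ ?_ ?_ b
      · intro y s hs
        simp only [loopTau_loopElt, lie_loopElt, lie_smul]
        rw [← lie_skew y x, loopElt_neg, show s + (r - 1) = r + s - 1 by ring,
          show r + (s - 1) = r + s - 1 by ring]
        push_cast
        module
      · simp
      · intro a b ha hb
        simp only [lie_add, add_lie, map_add, ha, hb]; abel
      · intro c a ha
        simp only [lie_smul, smul_lie, map_smul, ha, smul_sub]
    · simp
    · intro a b ha hb
      simp only [lie_add, add_lie, map_add, ha, hb]; abel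
    · intro c a ha
      simp only [lie_smul, smul_lie, map_smul, ha, smul_sub]

variable {g} in
/-- The adjoint action `x[r] ↦ [y, x][r]` of a constant element `y = y[0]` of `g[t, t⁻¹]`, as a
derivation of `t⁻¹ g[t⁻¹]`. -/
def constDer (y : g) : LieDerivation ℂ (negLoop g) (negLoop g) where
  toLinearMap := (LieAlgebra.ad ℂ (Loop g) (loopElt y 0)).restrict (p := (negLoop g).toSubmodule)
    (q := (negLoop g).toSubmodule) (by
      intro z hz
      refine negLoop_induction (p := fun z => LieAlgebra.ad ℂ (Loop g) (loopElt y 0) z ∈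
        (negLoop g).toSubmodule) ?_ ?_ ?_ ?_ ⟨z, hz⟩
      · intro x r hr
        rw [LieAlgebra.ad_apply, lie_loopElt]
        exact Submodule.subset_span ⟨_, _, by omega, rfl⟩
      · simp
      · intro a b ha hb; rw [map_add]; exact add_mem ha hb
      · intro c a ha; rw [map_smul]; exact Submodule.smul_mem _ _ ha)
  leibniz' := by
    intro a b
    apply Subtype.ext
    change ⁅loopElt y 0, ⁅(a : Loop g), (b : Loop g)⁆⁆ =
      ⁅(a : Loop g), ⁅loopElt y 0, (b : Loop g)⁆⁆ - ⁅(b : Loop g), ⁅loopElt y 0, (a : Loop g)⁆⁆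
    rw [leibniz_lie, ← lie_skew (b : Loop g)]
    abel

end Loop

/-! ### Extension of derivations to the universal enveloping algebra -/

section Env

variable {L : Type*} [LieRing L] [LieAlgebra ℂ L]

/-- For a derivation `D` of `L`, the algebra homomorphism `u ↦ u + ε D(u)` from `U(L)` to
`U(L)[ε]/(ε²)` determined by `x ↦ x + ε D(x)` for `x ∈ L`. -/
def dualHom (D : LieDerivation ℂ L L) :
    UniversalEnvelopingAlgebra ℂ L →ₐ[ℂ]
      TrivSqZeroExt (UniversalEnvelopingAlgebra ℂ L) (UniversalEnvelopingAlgebra ℂ L) :=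
  UniversalEnvelopingAlgebra.lift ℂ
    { toFun := fun x => TrivSqZeroExt.inl (UniversalEnvelopingAlgebra.ι ℂ x) +
        TrivSqZeroExt.inr (UniversalEnvelopingAlgebra.ι ℂ (D x))
      map_add' := by
        intro x y
        ext <;> simp
      map_smul' := by
        intro c x
        ext <;> simp
      map_lie' := by
        intro x y
        rw [LieRing.of_associative_ring_bracket]
        ext
        · simp [LieRing.of_associative_ring_bracket, -UniversalEnvelopingAlgebra.ι_apply]
        · simp [LieRing.of_associative_ring_bracket, -UniversalEnvelopingAlgebra.ι_apply]
          abel }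

/-- The derivation of `U(L)` that extends a derivation `D` of `L`. -/
def envDer (D : LieDerivation ℂ L L) :
    UniversalEnvelopingAlgebra ℂ L →ₗ[ℂ] UniversalEnvelopingAlgebra ℂ L :=
  (TrivSqZeroExt.sndHom _ _).restrictScalars ℂ ∘ₗ (dualHom D).toLinearMap

theorem dualHom_fst (D : LieDerivation ℂ L L) (u : UniversalEnvelopingAlgebra ℂ L) :
    (dualHom D u).fst = u := by
  have h : (TrivSqZeroExt.fstHom ℂ _ _).comp (dualHom D) =
      AlgHom.id ℂ (UniversalEnvelopingAlgebra ℂ L) := by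
    apply UniversalEnvelopingAlgebra.hom_ext
    ext x
    simp [dualHom]
  exact DFunLike.congr_fun h u

theorem envDer_ι (D : LieDerivation ℂ L L) (x : L) :
    envDer D (UniversalEnvelopingAlgebra.ι ℂ x) = UniversalEnvelopingAlgebra.ι ℂ (D x) := by
  simp [envDer, dualHom]

theorem envDer_mul (D : LieDerivation ℂ L L) (a b : UniversalEnvelopingAlgebra ℂ L) :
    envDer D (a * b) = a * envDer D b + envDer D a * b := by
  simp [envDer, dualHom_fst]

theorem envDer_algebraMap (D : LieDerivation ℂ L L) (c : ℂ) :
    envDer D (algebraMap ℂ _ c) = 0 := by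
  change (dualHom D (algebraMap ℂ _ c)).snd = 0
  rw [AlgHom.commutes]
  rfl

end Env

/-! ### The Harish-Chandra homomorphism -/

section HarishChandra

variable {g : Type*} [LieRing g] [LieAlgebra ℂ g]

variable (g) in
/-- The universal enveloping algebra `U(t⁻¹ g[t⁻¹])`. -/
abbrev UNeg := UniversalEnvelopingAlgebra ℂ (negLoop g)

/-- The element `x[r]`, `r < 0`, of `U(t⁻¹ g[t⁻¹])`. -/
def uElt (x : g) (r : ℤ) (hr : r < 0) : UNeg g :=
  UniversalEnvelopingAlgebra.ι ℂ (negElt x r hr)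

variable (g) in
/-- The operator `ad_τ` on `U(t⁻¹ g[t⁻¹])`: the derivation with `x[r] ↦ -r x[r - 1]`. -/
def adTau : UNeg g →ₗ[ℂ] UNeg g := envDer (tauDer g)

/-- The subalgebra `U(t⁻¹ g[t⁻¹])^h` of invariants under the adjoint action of `h ⊆ g`. -/
def invariants (h : LieSubalgebra ℂ g) : Subalgebra ℂ (UNeg g) where
  carrier := {u | ∀ y ∈ h, envDer (constDer y) u = 0}
  mul_mem' := by
    intro a b ha hb y hy
    rw [envDer_mul, ha y hy, hb y hy]; simp
  add_mem' := by
    intro a b ha hb y hy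
    rw [map_add, ha y hy, hb y hy, add_zero]
  algebraMap_mem' := fun c y _ => envDer_algebraMap _ c

/-- The inclusion `h[t, t⁻¹] → g[t, t⁻¹]` for a Lie subalgebra `h ⊆ g`. -/
def loopIncl (h : LieSubalgebra ℂ g) : Loop h →ₗ[ℂ] Loop g :=
  (LinearMap.lTensor (AddMonoidAlgebra ℂ ℤ) h.toSubmodule.subtype :
    AddMonoidAlgebra ℂ ℤ ⊗[ℂ] h →ₗ[ℂ] AddMonoidAlgebra ℂ ℤ ⊗[ℂ] g)

theorem loopIncl_loopElt (h : LieSubalgebra ℂ g) (x : h) (r : ℤ) :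
    loopIncl h (loopElt x r) = loopElt (x : g) r :=
  rfl

/-- The inclusion `t⁻¹ h[t⁻¹] → t⁻¹ g[t⁻¹]` for a Lie subalgebra `h ⊆ g`. -/
def negIncl (h : LieSubalgebra ℂ g) : negLoop h →ₗ⁅ℂ⁆ negLoop g where
  toLinearMap := (loopIncl h).restrict
    (p := (negLoop h).toSubmodule) (q := (negLoop g).toSubmodule) (by
      intro z hz
      refine negLoop_induction (p := fun z => loopIncl h z ∈ (negLoop g).toSubmodule) ?_ ?_ ?_ ?_ ⟨z, hz⟩
      · intro x r hr
        exact Submodule.subset_span ⟨(x : g), r, hr, rfl⟩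
      · simp
      · intro a b ha hb; rw [map_add]; exact add_mem ha hb
      · intro c a ha; rw [map_smul]; exact Submodule.smul_mem _ _ ha)
  map_lie' := by
    intro a b
    apply Subtype.ext
    change loopIncl h ⁅(a : Loop h), (b : Loop h)⁆ =
      ⁅loopIncl h (a : Loop h),
        loopIncl h (b : Loop h)⁆
    refine negLoop_induction (p := fun a => loopIncl h ⁅a, (b : Loop h)⁆ =
      ⁅loopIncl h a, loopIncl h (b : Loop h)⁆) ?_ ?_ ?_ ?_ a
    · intro x r hr
      refine negLoop_induction (p := fun b => loopIncl h ⁅loopElt x r, b⁆ =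
        ⁅loopIncl h (loopElt x r), loopIncl h b⁆) ?_ ?_ ?_ ?_ b
      · intro y s hs
        simp only [lie_loopElt, loopIncl_loopElt, LieSubalgebra.coe_bracket]
      · simp
      · intro a b ha hb
        simp only [lie_add, map_add, ha, hb]
      · intro c a ha
        simp only [lie_smul, map_smul, ha]
    · simp
    · intro a b ha hb
      simp only [add_lie, map_add, ha, hb]
    · intro c a ha
      simp only [smul_lie, map_smul, ha]

/-- The algebra homomorphism `U(t⁻¹ h[t⁻¹]) → U(t⁻¹ g[t⁻¹])` induced by the inclusion `h ⊆ g`. -/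
def cartanHom (h : LieSubalgebra ℂ g) : UNeg h →ₐ[ℂ] UNeg g :=
  UniversalEnvelopingAlgebra.lift ℂ ((UniversalEnvelopingAlgebra.ι ℂ).comp (negIncl h))

/-- For an abelian `h`, the map `U(t⁻¹ h[t⁻¹]) → U(t⁻¹ g[t⁻¹])` takes values in the invariants. -/
theorem cartanHom_mem (h : LieSubalgebra ℂ g) [IsLieAbelian h] (p : UNeg h) :
    cartanHom h p ∈ invariants h := by
  let f : UNeg h →ₐ[ℂ] invariants h :=
    UniversalEnvelopingAlgebra.lift ℂ
      { toFun := fun z => (⟨UniversalEnvelopingAlgebra.ι ℂ (negIncl h z), by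
          intro y hy
          rw [envDer_ι]
          have : constDer y (negIncl h z) = 0 := by
            apply Subtype.ext
            change ⁅loopElt y 0, loopIncl h (z : Loop h)⁆ = 0
            refine negLoop_induction (p := fun z => ⁅loopElt y 0,
              loopIncl h (z : Loop h)⁆ = 0) ?_ ?_ ?_ ?_ z
            · intro x r hr
              change ⁅loopElt y 0, loopElt (x : g) r⁆ = 0
              have hxy : ⁅(⟨y, hy⟩ : h), x⁆ = 0 := trivial_lie_zero _ _ _ _
              have hxy' : ⁅y, (x : g)⁆ = 0 := congrArg Subtype.val hxy
              rw [lie_loopElt, hxy', loopElt_zero]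
            · simp
            · intro a b ha hb; rw [map_add, lie_add, ha, hb, add_zero]
            · intro c a ha; rw [map_smul, lie_smul, ha, smul_zero]
          rw [this, map_zero]⟩ : invariants h)
        map_add' := by intro x y; apply Subtype.ext; simp
        map_smul' := by intro c x; apply Subtype.ext; simp
        map_lie' := by
          intro x y
          apply Subtype.ext
          change UniversalEnvelopingAlgebra.ι ℂ (negIncl h ⁅x, y⁆) =
            ⁅UniversalEnvelopingAlgebra.ι ℂ (negIncl h x),
              UniversalEnvelopingAlgebra.ι ℂ (negIncl h y)⁆
          rw [LieHom.map_lie, LieHom.map_lie] }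
  have hf : (invariants h).val.comp f = cartanHom h := by
    apply UniversalEnvelopingAlgebra.hom_ext
    ext x
    simp only [LieHom.coe_comp, Function.comp_apply, AlgHom.coe_toLieHom, AlgHom.comp_apply, f,
      cartanHom, UniversalEnvelopingAlgebra.lift_ι_apply]
    rfl
  rw [← hf]
  exact (f p).2

/-- The inclusion of `U(t⁻¹ h[t⁻¹])` into the invariants `U(t⁻¹ g[t⁻¹])^h`, for `h` abelian. -/
def cartanIncl (h : LieSubalgebra ℂ g) [IsLieAbelian h] : UNeg h →ₐ[ℂ] invariants h :=
  (cartanHom h).codRestrict (invariants h) (cartanHom_mem h)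

/-- `χ` is the Harish-Chandra homomorphism `U(t⁻¹ g[t⁻¹])^h → U(t⁻¹ h[t⁻¹])` with respect to the
left ideal `I` of `U(t⁻¹ g[t⁻¹])`: it is the quotient map of `U(t⁻¹ g[t⁻¹])^h` by its intersection
with `I`, the quotient being identified with `U(t⁻¹ h[t⁻¹])` through the images of the elements
of `h[r]`, `r < 0`. -/
structure IsHarishChandra (h : LieSubalgebra ℂ g) [IsLieAbelian h] (I : Ideal (UNeg g))
    (χ : invariants h →ₐ[ℂ] UNeg h) : Prop where
  /-- The kernel of `χ` is the intersection of the invariants with `I`. -/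
  eq_zero_iff : ∀ u : invariants h, χ u = 0 ↔ (u : UNeg g) ∈ I
  /-- `χ` is the identity on `U(t⁻¹ h[t⁻¹])`. -/
  apply_cartanIncl : ∀ p : UNeg h, χ (cartanIncl h p) = p

end HarishChandra

/-! ### The even orthogonal Lie algebra

The index set `[-n; n] = {-n, …, -1, 1, …, n}` is represented, in the same order, by `Fin (2 * n)`:
the position `p` stands for `p - n` if `p < n` and for `p - n + 1` otherwise. Thus `i ↦ -i` is
`Fin.rev`, and `-n, …, -1` are the positions `0, …, n - 1`. -/

section Orthogonal

variable (n : ℕ)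

/-- The matrix `J` with ones on the anti-diagonal and zeros elsewhere. -/
def antiJ : Matrix (Fin (2 * n)) (Fin (2 * n)) ℂ :=
  Matrix.of fun i j => if j = Fin.rev i then 1 else 0

/-- The Lie algebra `o_{2n}` of the matrices `X` with `Xᵀ J + J X = 0`. -/
abbrev orth : LieSubalgebra ℂ (Matrix (Fin (2 * n)) (Fin (2 * n)) ℂ) :=
  skewAdjointMatricesLieSubalgebra (antiJ n)

theorem mem_orth_iff (X : Matrix (Fin (2 * n)) (Fin (2 * n)) ℂ) :
    X ∈ orth n ↔ X.transpose * antiJ n + antiJ n * X = 0 := by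
  rw [mem_skewAdjointMatricesLieSubalgebra, mem_skewAdjointMatricesSubmodule,
    Matrix.IsSkewAdjoint, Matrix.IsAdjointPair, mul_neg, eq_neg_iff_add_eq_zero]

variable {n} in
/-- `F_{ij} = E_{ij} - E_{-j,-i}`, as an element of `o_{2n}`. -/
def F (i j : Fin (2 * n)) : orth n :=
  ⟨Matrix.single i j 1 - Matrix.single j.rev i.rev 1, by
    rw [mem_orth_iff]
    ext a b
    simp only [Matrix.add_apply, Matrix.mul_apply, Matrix.transpose_apply, Matrix.sub_apply,
      Matrix.single_apply, antiJ, Matrix.of_apply, Matrix.zero_apply, mul_ite, mul_one, mul_zero,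
      ite_mul, one_mul, zero_mul]
    have key : ∀ x : Fin (2 * n), (b = Fin.rev x) ↔ (x = Fin.rev b) := fun x =>
      ⟨fun h => by rw [h, Fin.rev_rev], fun h => by rw [h, Fin.rev_rev]⟩
    simp only [key, Finset.sum_ite_eq', Finset.mem_univ, if_true]
    have e1 : (i = b.rev ∧ j = a) ↔ (j.rev = a.rev ∧ i.rev = b) := by
      rw [Fin.rev_inj, Fin.rev_eq_iff]; tauto
    have e2 : (j.rev = b.rev ∧ i.rev = a) ↔ (i = a.rev ∧ j = b) := by
      rw [Fin.rev_inj, Fin.rev_eq_iff]; tauto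
    simp only [e1, e2]
    ring⟩

/-- The Cartan subalgebra `h` of `o_{2n}` generated by the elements `F_{ii}`. -/
def cartan : LieSubalgebra ℂ (orth n) :=
  LieSubalgebra.lieSpan ℂ (orth n) (Set.range fun i : Fin (2 * n) => F i i)

instance : IsLieAbelian (cartan n) := by
  rw [cartan, LieSubalgebra.isLieAbelian_lieSpan_iff]
  rintro _ ⟨i, rfl⟩ _ ⟨j, rfl⟩
  apply Subtype.ext
  have hF : ∀ i : Fin (2 * n), ((F i i : orth n) : Matrix (Fin (2 * n)) (Fin (2 * n)) ℂ) =
      Matrix.diagonal (Pi.single i 1 - Pi.single i.rev 1) := by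
    intro i
    simp only [F, ← Matrix.diagonal_single, Matrix.diagonal_sub]
    rfl
  change ⁅((F i i : orth n) : Matrix (Fin (2 * n)) (Fin (2 * n)) ℂ),
    ((F j j : orth n) : Matrix (Fin (2 * n)) (Fin (2 * n)) ℂ)⁆ = 0
  rw [LieRing.of_associative_ring_bracket, hF, hF, Matrix.diagonal_mul_diagonal,
    Matrix.diagonal_mul_diagonal, sub_eq_zero]
  congr 1
  ext k
  rw [mul_comm]

/-- The left ideal `I` of `U(t⁻¹ o_{2n}[t⁻¹])` generated by the `F_{ij}[r]` with `i < j`, `r < 0`. -/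
def upperIdeal : Ideal (UNeg (orth n)) :=
  Ideal.span {u | ∃ (i j : Fin (2 * n)) (r : ℤ) (hr : r < 0), i < j ∧ u = uElt (F i j) r hr}

/-- The entries `F̃_{ij}[-1] = (F[-1] J)_{ij}` of the skew-symmetric matrix `F̃[-1]`. -/
def tildeF (i j : Fin (2 * n)) : UNeg (orth n) :=
  ∑ k, antiJ n k j • uElt (F i k) (-1) (by norm_num)

/-- The Pfaffian
`Pf F̃[-1] = (2ⁿ n!)⁻¹ ∑_σ sgn(σ) F̃_{σ(-n),σ(-n+1)}[-1] ⋯ F̃_{σ(n-1),σ(n)}[-1]`, the factors being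
multiplied from left to right. -/
def pfaffian : UNeg (orth n) :=
  ((2 : ℂ) ^ n * (n.factorial : ℂ))⁻¹ •
    ∑ σ : Equiv.Perm (Fin (2 * n)), ((Equiv.Perm.sign σ : ℤ) : ℂ) •
      ((List.finRange n).map fun k : Fin n =>
        tildeF n (σ ⟨2 * k, by omega⟩) (σ ⟨2 * k + 1, by omega⟩)).prod

variable {n} in
/-- The position of the index `k - n ∈ {-n, …, -1}`, for `k = 0, …, n - 1`. -/
def negIdx (k : Fin n) : Fin (2 * n) := ⟨k, by omega⟩

variable {n} in
/-- The element `μ_i[r] = F_{ii}[r]` of `U(t⁻¹ h[t⁻¹])`, for `i = k - n ∈ {-n, …, -1}`. -/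
def mu (k : Fin n) (r : ℤ) (hr : r < 0) : UNeg (cartan n) :=
  uElt ⟨F (negIdx k) (negIdx k), LieSubalgebra.subset_lieSpan ⟨negIdx k, rfl⟩⟩ r hr

/-- The element `(μ_{-n}[-1] + ad_τ) ⋯ (μ_{-1}[-1] + ad_τ) · 1` of `U(t⁻¹ h[t⁻¹])`, where
`μ_i[-1]` acts by left multiplication. -/
def miuraProduct : UNeg (cartan n) :=
  ((List.finRange n).map fun k : Fin n =>
    (LinearMap.mulLeft ℂ (mu k (-1) (by norm_num)) + adTau (cartan n) :
      Module.End ℂ (UNeg (cartan n)))).prod 1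

end Orthogonal

end AffinePfaffian

end

attribute [local instance 100] LieRing.ofAssociativeRing

open scoped TensorProduct

noncomputable section

namespace AffinePfaffian

/-! ### Generators of enveloping algebras -/

section Generators

variable {L : Type*} [LieRing L] [LieAlgebra ℂ L]

/-! Write `I` for the upper ideal. The projection `χ` exists because every invariant is congruent
modulo `I` to exactly one element of the Cartan enveloping algebra, and because `I` is stable under
right multiplication by Cartan elements; `existsUnique_harishChandra` needs nothing more. Neither
half uses the PBW theorem.

Congruence: moving elements past lower triangular ones shows that `U` is spanned by the Cartan
image, `I` and vectors of negative degree for a grading element of the Cartan subalgebra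
(`triangularSum_eq_top`). An invariant has degree zero, so a polynomial in the grading derivation
removes its negative part (`exists_sub_cartanHom_mem`).

Uniqueness: the exterior algebra of a sum of evaluation modules contains vacuum vectors killed by
`I`, on which the Cartan part acts by a character. These characters are closed under addition and
separate points, so a Cartan element lying in `I` vanishes (`eq_zero_of_cartanHom_mem`).

For the Pfaffian, adjoin Grassmann variables `x_a` and put `Ω_T[r] = ½ ∑ x_a x_b F_{a,-b}[r]`, the
sum being over `a, b` in a symmetric index set `T`. Then `n!` times the Pfaffian is the top
coefficient of `Ω[-1]^n` over all indices (`factorial_smul_pfaffian`). Adjoining a pair `p, -p` to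
`T` adds `e = x_p A + x_{-p} B + x_p x_{-p} F_pp[-1]`, where `A` and `B` are linear forms. The
increment commutes with `Ω_T[-1]`, and `e³ = 0`. The anticommutator of `A` and `B` is `-2 Ω_T[-2]`
(`anticommutator_linForm`), so `e² = 2 x_p x_{-p} (BA + Ω_T[-2])`.

If `p` precedes all of `T`, the coefficients of `A` lie in `I`, so the `BA` term disappears modulo
`I`. Since `Ω_T[-1]` and `Ω_T[-2]` commute, the `Ω_T[-2]` term is `ad_τ` applied to a power of
`Ω_T[-1]`. Splitting off a pair thus applies `F_pp[-1] + ad_τ` modulo `I`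
(`IsTopCoeff.eval_quadForm_insert`), and doing this for all pairs from the outside inwards produces
the product. -/

theorem env_induction {p : UniversalEnvelopingAlgebra ℂ L → Prop}
    (hι : ∀ x, p (UniversalEnvelopingAlgebra.ι ℂ x)) (halg : ∀ c, p (algebraMap ℂ _ c))
    (hadd : ∀ a b, p a → p b → p (a + b)) (hmul : ∀ a b, p a → p b → p (a * b))
    (u : UniversalEnvelopingAlgebra ℂ L) : p u := by
  let S : Subalgebra ℂ (UniversalEnvelopingAlgebra ℂ L) :=
    { carrier := {u | p u}
      mul_mem' := fun ha hb => hmul _ _ ha hb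
      add_mem' := fun ha hb => hadd _ _ ha hb
      algebraMap_mem' := halg }
  let f : UniversalEnvelopingAlgebra ℂ L →ₐ[ℂ] S := UniversalEnvelopingAlgebra.lift ℂ
    { toFun := fun x => ⟨UniversalEnvelopingAlgebra.ι ℂ x, hι x⟩
      map_add' := fun _ _ => Subtype.ext (map_add _ _ _)
      map_smul' := fun _ _ => Subtype.ext (map_smul _ _ _)
      map_lie' := Subtype.ext (LieHom.map_lie _ _ _) }
  -- The lift into `S` followed by the inclusion fixes the generators, hence is the identity, so
  -- every `u` lies in `S`.
  have hf : S.val.comp f = AlgHom.id ℂ _ := by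
    apply UniversalEnvelopingAlgebra.hom_ext
    ext x
    simp only [LieHom.coe_comp, Function.comp_apply, AlgHom.coe_toLieHom, AlgHom.comp_apply, f,
      UniversalEnvelopingAlgebra.lift_ι_apply]
    rfl
  have := (f u).2
  rwa [show ((f u : S) : UniversalEnvelopingAlgebra ℂ L) = u from DFunLike.congr_fun hf u] at this

end Generators

/-! ### Calculus with the elements `x[r]`. -/

section LoopLemmas

variable {g : Type*} [LieRing g] [LieAlgebra ℂ g]

/-- The linear map `x ↦ x[r]` from `g` to `U(t⁻¹ g[t⁻¹])`. -/
def uLin (r : ℤ) (hr : r < 0) : g →ₗ[ℂ] UNeg g :=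
  (UniversalEnvelopingAlgebra.ι ℂ : negLoop g →ₗ⁅ℂ⁆ UNeg g).toLinearMap ∘ₗ
    { toFun := fun x => negElt x r hr
      map_add' := fun _ _ => Subtype.ext (TensorProduct.tmul_add _ _ _)
      map_smul' := fun c x => Subtype.ext (TensorProduct.tmul_smul c _ x) }

theorem uLin_apply (r : ℤ) (hr : r < 0) (x : g) : uLin r hr x = uElt x r hr := rfl

theorem uElt_sum {κ : Type*} (s : Finset κ) (x : κ → g) (r : ℤ) (hr : r < 0) :
    uElt (∑ k ∈ s, x k) r hr = ∑ k ∈ s, uElt (x k) r hr :=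
  map_sum (uLin r hr) x s

theorem uElt_smul (c : ℂ) (x : g) (r : ℤ) (hr : r < 0) :
    uElt (c • x) r hr = c • uElt x r hr :=
  map_smul (uLin r hr) c x

theorem uElt_neg (x : g) (r : ℤ) (hr : r < 0) : uElt (-x) r hr = -uElt x r hr :=
  map_neg (uLin r hr) x

theorem uElt_lie (x y : g) (r s : ℤ) (hr : r < 0) (hs : s < 0) :
    uElt x r hr * uElt y s hs - uElt y s hs * uElt x r hr =
      uElt ⁅x, y⁆ (r + s) (by omega) := by
  have h : ⁅negElt x r hr, negElt y s hs⁆ = negElt ⁅x, y⁆ (r + s) (by omega) :=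
    Subtype.ext (lie_loopElt g x y r s)
  rw [uElt, uElt, uElt, ← h, LieHom.map_lie, LieRing.of_associative_ring_bracket]

theorem uElt_mul (x y : g) (r s : ℤ) (hr : r < 0) (hs : s < 0) :
    uElt x r hr * uElt y s hs = uElt y s hs * uElt x r hr + uElt ⁅x, y⁆ (r + s) (by omega) := by
  rw [← uElt_lie x y r s hr hs]; abel

theorem negLoop_induction_subtype {p : negLoop g → Prop}
    (helt : ∀ (x : g) (r : ℤ) (hr : r < 0), p (negElt x r hr))
    (hzero : p 0) (hadd : ∀ a b, p a → p b → p (a + b)) (hsmul : ∀ (c : ℂ) a, p a → p (c • a))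
    (z : negLoop g) : p z := by
  obtain ⟨z, hz⟩ := z
  have hz' : z ∈ Submodule.span ℂ {z : Loop g | ∃ (x : g) (r : ℤ), r < 0 ∧ z = loopElt x r} := hz
  induction hz' using Submodule.span_induction with
  | mem a ha => obtain ⟨x, r, hr, rfl⟩ := ha; exact helt x r hr
  | zero => exact hzero
  | add a b ha hb h1 h2 => exact hadd _ _ (h1 ha) (h2 hb)
  | smul c a ha h => exact hsmul c _ (h ha)

theorem uNeg_induction {p : UNeg g → Prop}
    (helt : ∀ (x : g) (r : ℤ) (hr : r < 0), p (uElt x r hr)) (halg : ∀ c, p (algebraMap ℂ _ c))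
    (hadd : ∀ a b, p a → p b → p (a + b)) (hmul : ∀ a b, p a → p b → p (a * b))
    (u : UNeg g) : p u := by
  refine env_induction (fun x => ?_) halg hadd hmul u
  refine negLoop_induction_subtype (p := fun x => p (UniversalEnvelopingAlgebra.ι ℂ x))
    helt ?_ ?_ ?_ x
  · rw [map_zero]; simpa using halg 0
  · intro a b ha hb; rw [map_add]; exact hadd _ _ ha hb
  · intro c a ha; rw [map_smul, Algebra.smul_def]; exact hmul _ _ (halg c) ha

/-- A subspace containing `1` that is stable under left multiplication by the `x[r]` is the whole
enveloping algebra. -/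
theorem submodule_eq_top (S : Submodule ℂ (UNeg g)) (h1 : 1 ∈ S)
    (hS : ∀ (x : g) (r : ℤ) (hr : r < 0), ∀ s ∈ S, uElt x r hr * s ∈ S) : S = ⊤ := by
  have key : ∀ u : UNeg g, ∀ s ∈ S, u * s ∈ S := by
    intro u
    induction u using uNeg_induction with
    | helt x r hr => exact hS x r hr
    | halg c => intro s hs; rw [← Algebra.smul_def]; exact S.smul_mem c hs
    | hadd a b ha hb => intro s hs; rw [add_mul]; exact S.add_mem (ha s hs) (hb s hs)
    | hmul a b ha hb => intro s hs; rw [mul_assoc]; exact ha _ (hb s hs)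
  rw [eq_top_iff]
  intro u _
  simpa using key u 1 h1

theorem envDer_constDer_uElt (y x : g) (r : ℤ) (hr : r < 0) :
    envDer (constDer y) (uElt x r hr) = uElt ⁅y, x⁆ r hr := by
  rw [uElt, envDer_ι, uElt]
  congr 1
  apply Subtype.ext
  change ⁅loopElt y 0, loopElt x r⁆ = loopElt ⁅y, x⁆ r
  rw [lie_loopElt, zero_add]

theorem adTau_uElt (x : g) (r : ℤ) (hr : r < 0) :
    adTau g (uElt x r hr) = (-(r : ℂ)) • uElt x (r - 1) (by omega) := by
  rw [adTau, uElt, envDer_ι, uElt, ← map_smul]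
  congr 1
  apply Subtype.ext
  exact loopTau_loopElt g x r

theorem cartanHom_uElt (h : LieSubalgebra ℂ g) (x : h) (r : ℤ) (hr : r < 0) :
    cartanHom h (uElt x r hr) = uElt (x : g) r hr := by
  rw [cartanHom, uElt, UniversalEnvelopingAlgebra.lift_ι_apply]
  rfl

theorem envDer_one {L : Type*} [LieRing L] [LieAlgebra ℂ L] (D : LieDerivation ℂ L L) :
    envDer D 1 = 0 := by
  rw [← map_one (algebraMap ℂ (UniversalEnvelopingAlgebra ℂ L)), envDer_algebraMap]

theorem adTau_mul (a b : UNeg g) : adTau g (a * b) = a * adTau g b + adTau g a * b :=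
  envDer_mul _ a b

theorem cartanHom_adTau (h : LieSubalgebra ℂ g) (p : UNeg h) :
    cartanHom h (adTau h p) = adTau g (cartanHom h p) := by
  induction p using uNeg_induction with
  | helt x r hr => simp [adTau_uElt, cartanHom_uElt]
  | halg c => simp [adTau, envDer_algebraMap]
  | hadd a b ha hb => simp [ha, hb]
  | hmul a b ha hb =>
    rw [adTau_mul, map_mul, adTau_mul, map_add, map_mul, map_mul, ha, hb]

end LoopLemmas

/-! ### The matrices `F i j` -/

section FMatrices

variable {n : ℕ}

theorem orth_coe_add (x y : orth n) :
    ((x + y : orth n) : Matrix (Fin (2 * n)) (Fin (2 * n)) ℂ) = x + y := rfl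

theorem orth_coe_sub (x y : orth n) :
    ((x - y : orth n) : Matrix (Fin (2 * n)) (Fin (2 * n)) ℂ) = x - y := rfl

theorem orth_coe_smul (c : ℂ) (x : orth n) :
    ((c • x : orth n) : Matrix (Fin (2 * n)) (Fin (2 * n)) ℂ) = c • x := rfl

theorem F_coe (i j : Fin (2 * n)) : ((F i j : orth n) : Matrix (Fin (2 * n)) (Fin (2 * n)) ℂ) =
    Matrix.single i j 1 - Matrix.single j.rev i.rev 1 := rfl

theorem F_rev (i j : Fin (2 * n)) : F j.rev i.rev = -F i j := by
  apply Subtype.ext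
  simp [F_coe]

theorem single_mul_single_ite {m : Type*} [Fintype m] [DecidableEq m] (i j k l : m) :
    (Matrix.single i j 1 * Matrix.single k l 1 : Matrix m m ℂ) =
      (if j = k then (1 : ℂ) else 0) • Matrix.single i l 1 := by
  split_ifs with h
  · subst h; simp
  · simp [h]

theorem lie_F_F (i j k l : Fin (2 * n)) :
    ⁅F i j, F k l⁆ = (if j = k then (1 : ℂ) else 0) • F i l - (if i = l then (1 : ℂ) else 0) • F k j
      - (if i.rev = k then (1 : ℂ) else 0) • F j.rev l
      + (if j.rev = l then (1 : ℂ) else 0) • F k i.rev := by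
  apply Subtype.ext
  simp only [LieSubalgebra.coe_bracket, LieRing.of_associative_ring_bracket,
    orth_coe_add, orth_coe_sub, orth_coe_smul, F_coe, mul_sub, sub_mul, single_mul_single_ite, Fin.rev_rev, Fin.rev_inj, smul_sub]
  have e1 : (j = l.rev) = (j.rev = l) := by rw [Fin.rev_eq_iff]
  have e2 : (k.rev = i) = (i.rev = k) := by
    rw [Fin.rev_eq_iff, eq_iff_iff, eq_comm]
  have e3 : (l = j.rev) = (j.rev = l) := by rw [eq_iff_iff, eq_comm]
  have e4 : (k = j) = (j = k) := by rw [eq_iff_iff, eq_comm]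
  have e5 : (l = i) = (i = l) := by rw [eq_iff_iff, eq_comm]
  simp only [e1, e2, e3, e4, e5]
  abel

theorem orth_apply_rev (X : orth n) (i j : Fin (2 * n)) :
    (X : Matrix (Fin (2 * n)) (Fin (2 * n)) ℂ) j.rev i.rev =
      -(X : Matrix (Fin (2 * n)) (Fin (2 * n)) ℂ) i j := by
  have h := (mem_orth_iff n _).1 X.2
  have h' := congrFun (congrFun h j) i.rev
  have key : ∀ x : Fin (2 * n), (i.rev = Fin.rev x) ↔ (x = i) := fun x => by
    rw [Fin.rev_inj, eq_comm]
  simp [Matrix.mul_apply, antiJ, key] at h'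
  linear_combination h'

/-- Skew-symmetry makes each entry of `X` occur twice in the sum, whence the factor ½. The `F i j`
are not linearly independent, but spanning is enough below. -/
theorem orth_eq_sum (X : orth n) :
    X = (2⁻¹ : ℂ) • ∑ i, ∑ j, (X : Matrix (Fin (2 * n)) (Fin (2 * n)) ℂ) i j • F i j := by
  apply Subtype.ext
  rw [orth_coe_smul]
  change _ = (2⁻¹ : ℂ) • (orth n).toSubmodule.subtype _
  simp only [map_sum, map_smul, Submodule.subtype_apply]
  ext a b
  have h := orth_apply_rev X a b
  have h1 : ∀ x : Fin (2 * n), (x.rev = a) ↔ (x = a.rev) := fun x => by rw [Fin.rev_eq_iff]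
  have h2 : ∀ x : Fin (2 * n), (x.rev = b) ↔ (x = b.rev) := fun x => by rw [Fin.rev_eq_iff]
  simp [Matrix.sum_apply, F_coe, Matrix.single_apply, mul_sub, Finset.sum_sub_distrib, h1, h2, ite_and, h]
  ring

/-- A diagonal `y` in `orth n` has `c i.rev = -c i`, so the two matrix units that make up `F i j`
have the same weight. -/
theorem lie_diagonal_F {y : orth n} {c : Fin (2 * n) → ℂ}
    (hy : (y : Matrix (Fin (2 * n)) (Fin (2 * n)) ℂ) = Matrix.diagonal c) (i j : Fin (2 * n)) :
    ⁅y, F i j⁆ = (c i - c j) • F i j := by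
  have hc : ∀ i, c i.rev = -c i := fun i => by
    have := orth_apply_rev y i i
    simpa [hy] using this
  apply Subtype.ext
  rw [LieSubalgebra.coe_bracket, hy, LieRing.of_associative_ring_bracket, orth_coe_smul,
    F_coe]
  ext a b
  simp only [Matrix.sub_apply, Matrix.diagonal_mul, Matrix.mul_diagonal, Matrix.single_apply,
    Matrix.smul_apply, smul_eq_mul]
  split_ifs with h1 h2 h2
  · obtain ⟨rfl, rfl⟩ := h1; ring
  · obtain ⟨rfl, rfl⟩ := h1; ring
  · obtain ⟨rfl, rfl⟩ := h2; rw [hc, hc]; ring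
  · ring

theorem cartan_diagonal {y : orth n} (hy : y ∈ cartan n) :
    ∃ c : Fin (2 * n) → ℂ, (y : Matrix (Fin (2 * n)) (Fin (2 * n)) ℂ) = Matrix.diagonal c := by
  rw [cartan] at hy
  induction hy using LieSubalgebra.lieSpan_induction with
  | mem x hx =>
    obtain ⟨i, rfl⟩ := hx
    exact ⟨Pi.single i 1 - Pi.single i.rev 1, by
      simp only [F_coe, ← Matrix.diagonal_single, Matrix.diagonal_sub]; rfl⟩
  | zero => exact ⟨0, by simp⟩
  | smul a x _ h => obtain ⟨c, hc⟩ := h; exact ⟨a • c, by simp [hc, Matrix.diagonal_smul]⟩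
  | add x y _ _ h1 h2 =>
    obtain ⟨c, hc⟩ := h1; obtain ⟨d, hd⟩ := h2
    exact ⟨c + d, by rw [orth_coe_add, hc, hd, Matrix.diagonal_add]; rfl⟩
  | lie x y _ _ h1 h2 =>
    obtain ⟨c, hc⟩ := h1; obtain ⟨d, hd⟩ := h2
    refine ⟨0, ?_⟩
    rw [LieSubalgebra.coe_bracket, hc, hd, LieRing.of_associative_ring_bracket,
      Matrix.diagonal_mul_diagonal, Matrix.diagonal_mul_diagonal]
    simp [mul_comm]

theorem tildeF_eq (i j : Fin (2 * n)) : tildeF n i j = uElt (F i j.rev) (-1) (by norm_num) := by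
  have h : ∀ k : Fin (2 * n), (j = k.rev) ↔ (k = j.rev) := fun k =>
    ⟨fun h => by rw [h, Fin.rev_rev], fun h => by rw [h, Fin.rev_rev]⟩
  simp [tildeF, antiJ, h]

end FMatrices

/-! ### Existence and uniqueness of the projection -/

section Projection

variable {g : Type*} [LieRing g] [LieAlgebra ℂ g] {h : LieSubalgebra ℂ g} [IsLieAbelian h]
  {I : Ideal (UNeg g)}

/-- To evaluate `χ` it suffices to find a Cartan representative modulo `I`. This gives both the
uniqueness of `χ` and the final formula. -/
theorem IsHarishChandra.apply_eq {χ : invariants h →ₐ[ℂ] UNeg h} (hχ : IsHarishChandra h I χ)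
    {u : invariants h} {p : UNeg h} (hu : (u : UNeg g) - cartanHom h p ∈ I) : χ u = p := by
  have h0 : χ (u - cartanIncl h p) = 0 := (hχ.eq_zero_iff _).2 hu
  rwa [map_sub, hχ.apply_cartanIncl, sub_eq_zero] at h0

/-- As `I` is only a left ideal, multiplicativity needs `hmul`: with `p`, `q` the Cartan parts of
`u`, `v`, one has `uv - pq = u(v - q) + (u - p)q`. -/
theorem existsUnique_harishChandra
    (hspan : ∀ u ∈ invariants h, ∃ p : UNeg h, u - cartanHom h p ∈ I)
    (hinj : ∀ p : UNeg h, cartanHom h p ∈ I → p = 0)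
    (hmul : ∀ w ∈ I, ∀ p : UNeg h, w * cartanHom h p ∈ I) :
    ∃! χ : invariants h →ₐ[ℂ] UNeg h, IsHarishChandra h I χ := by
  choose f hf using fun u : invariants h => hspan u u.2
  have huniq : ∀ (u : invariants h) (p : UNeg h), (u : UNeg g) - cartanHom h p ∈ I → f u = p := by
    intro u p hp
    rw [← sub_eq_zero]
    apply hinj
    have := I.sub_mem hp (hf u)
    rwa [sub_sub_sub_cancel_left, ← map_sub] at this
  let χ : invariants h →ₐ[ℂ] UNeg h :=
    { toFun := f
      map_one' := huniq _ _ (by simp)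
      map_zero' := huniq _ _ (by simp)
      map_mul' := fun u v => huniq _ _ (by
        have e : ((u * v : invariants h) : UNeg g) - cartanHom h (f u * f v) =
            u * ((v : UNeg g) - cartanHom h (f v)) +
              ((u : UNeg g) - cartanHom h (f u)) * cartanHom h (f v) := by
          rw [map_mul]; change (u : UNeg g) * v - _ = _; noncomm_ring
        rw [e]
        exact I.add_mem (I.mul_mem_left _ (hf v)) (hmul _ (hf u) _))
      map_add' := fun u v => huniq _ _ (by
        have e : ((u + v : invariants h) : UNeg g) - cartanHom h (f u + f v) =
            ((u : UNeg g) - cartanHom h (f u)) + ((v : UNeg g) - cartanHom h (f v)) := by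
          rw [map_add]; change (u : UNeg g) + v - _ = _; abel
        rw [e]
        exact I.add_mem (hf u) (hf v))
      commutes' := fun c => huniq _ _ (by
        rw [AlgHom.commutes]; change algebraMap ℂ (UNeg g) c - _ ∈ I; simp) }
  have hχ : IsHarishChandra h I χ :=
    { eq_zero_iff := fun u => by
        change f u = 0 ↔ _
        constructor
        · intro h0
          have := hf u
          rwa [h0, map_zero, sub_zero] at this
        · intro hu
          exact huniq u 0 (by rwa [map_zero, sub_zero])
      apply_cartanIncl := fun p => huniq _ _ (by
        change cartanHom h p - cartanHom h p ∈ I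
        simp) }
  refine ⟨χ, hχ, fun ψ hψ => ?_⟩
  ext u
  exact hψ.apply_eq (hf u)

end Projection

/-! ### The upper triangular left ideal -/

section Ideal

variable {n : ℕ}

theorem uElt_mem_upperIdeal {i j : Fin (2 * n)} (hij : i < j) (r : ℤ) (hr : r < 0) :
    uElt (F i j) r hr ∈ upperIdeal n :=
  Ideal.subset_span ⟨i, j, r, hr, hij, rfl⟩

/-- Induction on the elements of the left ideal generated by the `F_{ij}[r]` with `i < j`. -/
theorem upperIdeal_induction {p : UNeg (orth n) → Prop}
    (hgen : ∀ (i j : Fin (2 * n)) (r : ℤ) (hr : r < 0), i < j → p (uElt (F i j) r hr))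
    (hzero : p 0) (hadd : ∀ a b, p a → p b → p (a + b))
    (hmul : ∀ a, ∀ b ∈ upperIdeal n, p b → p (a * b)) {w : UNeg (orth n)}
    (hw : w ∈ upperIdeal n) : p w := by
  have hw' := hw
  rw [upperIdeal, Ideal.span] at hw'
  induction hw' using Submodule.span_induction with
  | mem x hx => obtain ⟨i, j, r, hr, hij, rfl⟩ := hx; exact hgen i j r hr hij
  | zero => exact hzero
  | add a b ha hb h1 h2 => exact hadd a b (h1 ha) (h2 hb)
  | smul c a ha h => exact hmul c a ha (h ha)

theorem upperIdeal_smul_mem (c : ℂ) {w : UNeg (orth n)} (hw : w ∈ upperIdeal n) :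
    c • w ∈ upperIdeal n := by
  rw [Algebra.smul_def]; exact (upperIdeal n).mul_mem_left _ hw

/-- Cartan elements act diagonally on root vectors: commuting `F_{ij}[r]` past `x[s]` costs only a
multiple of `F_{ij}[r+s]`, which is again upper triangular. -/
theorem upperIdeal_mul_cartanHom {w : UNeg (orth n)} (hw : w ∈ upperIdeal n)
    (p : UNeg (cartan n)) : w * cartanHom (cartan n) p ∈ upperIdeal n := by
  induction p using uNeg_induction generalizing w with
  | helt x s hs =>
    rw [cartanHom_uElt]
    refine upperIdeal_induction (p := fun w => w * uElt (x : orth n) s hs ∈ upperIdeal n)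
      ?_ ?_ ?_ ?_ hw
    · intro i j r hr hij
      obtain ⟨c, hc⟩ := cartan_diagonal x.2
      rw [uElt_mul, ← lie_skew, lie_diagonal_F hc, uElt_neg, uElt_smul]
      exact (upperIdeal n).add_mem ((upperIdeal n).mul_mem_left _ (uElt_mem_upperIdeal hij _ _))
        ((upperIdeal n).neg_mem (upperIdeal_smul_mem _ (uElt_mem_upperIdeal hij _ _)))
    · rw [zero_mul]; exact (upperIdeal n).zero_mem
    · intro a b ha hb; rw [add_mul]; exact (upperIdeal n).add_mem ha hb
    · intro a b _ hb; rw [mul_assoc]; exact (upperIdeal n).mul_mem_left _ hb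
  | halg c =>
    rw [AlgHom.commutes, ← Algebra.commutes]
    exact (upperIdeal n).mul_mem_left _ hw
  | hadd a b ha hb =>
    rw [map_add, mul_add]; exact (upperIdeal n).add_mem (ha hw) (hb hw)
  | hmul a b ha hb =>
    rw [map_mul, ← mul_assoc]; exact hb (ha hw)

theorem envDer_mem_upperIdeal {y : orth n} (hy : y ∈ cartan n) {w : UNeg (orth n)}
    (hw : w ∈ upperIdeal n) : envDer (constDer y) w ∈ upperIdeal n := by
  obtain ⟨c, hc⟩ := cartan_diagonal hy
  refine upperIdeal_induction (p := fun w => envDer (constDer y) w ∈ upperIdeal n) ?_ ?_ ?_ ?_ hw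
  · intro i j r hr hij
    rw [envDer_constDer_uElt, lie_diagonal_F hc, uElt_smul]
    exact upperIdeal_smul_mem _ (uElt_mem_upperIdeal hij _ _)
  · rw [map_zero]; exact (upperIdeal n).zero_mem
  · intro a b ha hb; rw [map_add]; exact (upperIdeal n).add_mem ha hb
  · intro a b hb' hb
    rw [envDer_mul]
    exact (upperIdeal n).add_mem ((upperIdeal n).mul_mem_left _ hb)
      ((upperIdeal n).mul_mem_left _ hb')

/-- A generator is only shifted in its power of `t`. Hence congruences modulo the ideal may be
differentiated, as the recurrence for the Pfaffians requires. -/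
theorem adTau_mem_upperIdeal {w : UNeg (orth n)} (hw : w ∈ upperIdeal n) :
    adTau (orth n) w ∈ upperIdeal n := by
  refine upperIdeal_induction (p := fun w => adTau (orth n) w ∈ upperIdeal n) ?_ ?_ ?_ ?_ hw
  · intro i j r hr hij
    rw [adTau_uElt]
    exact upperIdeal_smul_mem _ (uElt_mem_upperIdeal hij _ _)
  · rw [map_zero]; exact (upperIdeal n).zero_mem
  · intro a b ha hb; rw [map_add]; exact (upperIdeal n).add_mem ha hb
  · intro a b hb' hb
    rw [adTau_mul]
    exact (upperIdeal n).add_mem ((upperIdeal n).mul_mem_left _ hb)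
      ((upperIdeal n).mul_mem_left _ hb')

end Ideal

/-! ### The triangular decomposition -/

section Generic

theorem mul_mem_of_mem_span {A : Type*} [Ring A] [Algebra ℂ A] {G : Set A} {S : Submodule ℂ A}
    {a : A} (h : ∀ v ∈ G, a * v ∈ S) {v : A} (hv : v ∈ Submodule.span ℂ G) : a * v ∈ S := by
  induction hv using Submodule.span_induction with
  | mem v hv => exact h v hv
  | zero => rw [mul_zero]; exact zero_mem _
  | add a b _ _ h1 h2 => rw [mul_add]; exact add_mem h1 h2
  | smul c a _ h => rw [mul_smul_comm]; exact Submodule.smul_mem _ _ h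

/-- The span of the eigenvectors of `D` with negative integral eigenvalues. -/
def eigenSpan {E : Type*} [AddCommGroup E] [Module ℂ E] (D : E →ₗ[ℂ] E) : Submodule ℂ E :=
  Submodule.span ℂ {v | ∃ k : ℕ, 0 < k ∧ D v = (-(k : ℂ)) • v}

/-- Eigenvalues add under a derivation. Only `k` has to be positive; `m = 0` covers vectors coming
from the Cartan part. -/
theorem mul_mem_eigenSpan {A : Type*} [Ring A] [Algebra ℂ A] {D : A →ₗ[ℂ] A}
    (hD : ∀ a b, D (a * b) = a * D b + D a * b) {y v : A} {k m : ℕ} (hk : 0 < k)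
    (hy : D y = (-(k : ℂ)) • y) (hv : D v = (-(m : ℂ)) • v) : y * v ∈ eigenSpan D := by
  refine Submodule.subset_span ⟨m + k, by omega, ?_⟩
  rw [hD, hv, hy, mul_smul_comm, smul_mul_assoc, ← add_smul]
  congr 1
  push_cast
  ring

/-- A sum of eigenvectors with nonzero eigenvalues is annihilated by a polynomial with nonzero
constant term. -/
theorem exists_aeval_eq_zero {E : Type*} [AddCommGroup E] [Module ℂ E] (D : E →ₗ[ℂ] E) {v : E}
    (hv : v ∈ eigenSpan D) :
    ∃ q : Polynomial ℂ, q.coeff 0 ≠ 0 ∧ Polynomial.aeval D q v = 0 := by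
  induction hv using Submodule.span_induction with
  | mem v hv =>
    obtain ⟨k, hk, hv⟩ := hv
    refine ⟨Polynomial.X + Polynomial.C (k : ℂ), by simp [hk.ne'], ?_⟩
    rw [map_add, Polynomial.aeval_X, Polynomial.aeval_C, LinearMap.add_apply, hv,
      Module.algebraMap_end_apply, neg_smul, neg_add_cancel]
  | zero => exact ⟨1, by simp, by simp⟩
  | add a b _ _ h1 h2 =>
    obtain ⟨p, hp, hpa⟩ := h1
    obtain ⟨q, hq, hqb⟩ := h2
    refine ⟨p * q, by simp [Polynomial.mul_coeff_zero, hp, hq], ?_⟩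
    rw [map_add, map_mul]
    have e1 : (Polynomial.aeval D p * Polynomial.aeval D q) a = 0 := by
      rw [← map_mul, mul_comm, map_mul, Module.End.mul_apply, hpa, map_zero]
    rw [e1, Module.End.mul_apply, hqb, map_zero, add_zero]
  | smul c a _ h =>
    obtain ⟨p, hp, hpa⟩ := h
    exact ⟨p, hp, by rw [map_smul, hpa, smul_zero]⟩

theorem aeval_apply_of_apply_eq_zero {E : Type*} [AddCommGroup E] [Module ℂ E] (D : E →ₗ[ℂ] E)
    {w : E} (hw : D w = 0) (q : Polynomial ℂ) : Polynomial.aeval D q w = q.coeff 0 • w := by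
  conv_lhs => rw [← Polynomial.divX_mul_X_add q]
  rw [map_add, map_mul, LinearMap.add_apply, Module.End.mul_apply, Polynomial.aeval_X, hw,
    map_zero, zero_add, Polynomial.aeval_C, Module.algebraMap_end_apply]

theorem aeval_apply_mem {E : Type*} [AddCommGroup E] [Module ℂ E] (D : E →ₗ[ℂ] E)
    {S : Submodule ℂ E} (hS : ∀ w ∈ S, D w ∈ S) {w : E} (hw : w ∈ S) (q : Polynomial ℂ) :
    Polynomial.aeval D q w ∈ S := by
  rw [Polynomial.aeval_eq_sum_range, LinearMap.sum_apply]
  refine sum_mem fun k hk => ?_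
  clear hk
  rw [LinearMap.smul_apply]
  refine Submodule.smul_mem _ _ ?_
  induction k with
  | zero => exact hw
  | succ k ih =>
    rw [pow_succ', Module.End.mul_apply]
    exact hS _ ih

end Generic

/-! ### The principal grading and the spanning half of the decomposition. -/

section Triangular

variable (n : ℕ)

/-- The height `ρ_i`, with `ρ_i - ρ_j = 2 (j - i)`. -/
def height (i : Fin (2 * n)) : ℂ := 2 * n - 1 - 2 * (i : ℕ)

theorem height_rev (i : Fin (2 * n)) : height n i.rev = -height n i := by
  have : ((i.rev : ℕ) : ℂ) = 2 * n - 1 - (i : ℕ) := by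
    rw [Fin.val_rev, Nat.cast_sub (by omega)]; push_cast; ring
  rw [height, height, this]; ring

/-- The element of the Cartan subalgebra that defines the principal grading. -/
def gradingElt : orth n := ∑ i, (height n i / 2) • F i i

theorem F_mem_cartan (i : Fin (2 * n)) : F i i ∈ cartan n := LieSubalgebra.subset_lieSpan ⟨i, rfl⟩

theorem gradingElt_mem : gradingElt n ∈ cartan n :=
  sum_mem fun i _ => (cartan n).smul_mem _ (F_mem_cartan n i)

/-- Both `height n i` and `F i i` change sign under `Fin.rev`, so the terms at `i` and `i.rev`
agree; this accounts for the ½ in `gradingElt`. -/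
theorem gradingElt_coe : (gradingElt n : Matrix (Fin (2 * n)) (Fin (2 * n)) ℂ) =
    Matrix.diagonal (height n) := by
  change (orth n).toSubmodule.subtype _ = _
  simp only [gradingElt, map_sum, map_smul, Submodule.subtype_apply]
  ext a b
  have h1 : ∀ x : Fin (2 * n), (x.rev = a) ↔ (x = a.rev) := fun x => by rw [Fin.rev_eq_iff]
  simp [Matrix.sum_apply, F_coe, Matrix.single_apply, mul_sub, Finset.sum_sub_distrib, h1, ite_and,
    Matrix.diagonal_apply, height_rev]
  split_ifs <;> ring

/-- The span of the vectors of negative degree. -/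
def negPart : Submodule ℂ (UNeg (orth n)) := eigenSpan (envDer (constDer (gradingElt n)))

/-- The sum of the image of `U(t⁻¹ h[t⁻¹])`, of the left ideal, and of the span of the vectors of
negative degree. -/
def triangularSum : Submodule ℂ (UNeg (orth n)) :=
  LinearMap.range (cartanHom (cartan n)).toLinearMap ⊔
    ((upperIdeal n).restrictScalars ℂ ⊔ negPart n)

variable {n}

theorem envDer_lower {i j : Fin (2 * n)} (hij : j < i) (r : ℤ) (hr : r < 0) :
    ∃ k : ℕ, 0 < k ∧ envDer (constDer (gradingElt n)) (uElt (F i j) r hr) =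
      (-(k : ℂ)) • uElt (F i j) r hr := by
  obtain ⟨d, hd⟩ := Nat.exists_eq_add_of_lt hij
  refine ⟨2 * (d + 1), by omega, ?_⟩
  rw [envDer_constDer_uElt, lie_diagonal_F (gradingElt_coe n), uElt_smul, height, height, hd]
  congr 1
  push_cast
  ring

/-- A lower triangular factor has negative degree: it sends the Cartan part (degree zero) and the
negative part into the negative part, and it preserves the left ideal. -/
theorem lower_mul_mem_triangularSum {i j : Fin (2 * n)} (hij : j < i) (r : ℤ) (hr : r < 0)
    {w : UNeg (orth n)} (hw : w ∈ triangularSum n) :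
    uElt (F i j) r hr * w ∈ triangularSum n := by
  obtain ⟨k, hk, hy⟩ := envDer_lower hij r hr
  generalize uElt (F i j) r hr = y at *
  obtain ⟨a, ⟨p, hp⟩, w', hw', rfl⟩ := Submodule.mem_sup.1 hw
  obtain ⟨b, hb, v, hv, rfl⟩ := Submodule.mem_sup.1 hw'
  have ha : envDer (constDer (gradingElt n)) a = (-((0 : ℕ) : ℂ)) • a := by
    rw [Nat.cast_zero, neg_zero, zero_smul, ← hp]
    exact cartanHom_mem (cartan n) p _ (gradingElt_mem n)
  have h1 : y * a ∈ negPart n := mul_mem_eigenSpan (envDer_mul _) hk hy ha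
  have h2 : y * b ∈ (upperIdeal n).restrictScalars ℂ := (upperIdeal n).mul_mem_left _ hb
  have h3 : y * v ∈ negPart n :=
    mul_mem_of_mem_span (S := negPart n)
      (fun v hv' => by
        obtain ⟨m, _, hv'⟩ := hv'
        exact mul_mem_eigenSpan (envDer_mul _) hk hy hv') hv
  rw [mul_add, mul_add]
  exact add_mem (Submodule.mem_sup_right (Submodule.mem_sup_right h1))
    (add_mem (Submodule.mem_sup_right (Submodule.mem_sup_left h2))
      (Submodule.mem_sup_right (Submodule.mem_sup_right h3)))

variable (n) in
/-- The vectors obtained from `U(t⁻¹ h[t⁻¹])` and the left ideal by applying lower triangular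
elements. -/
inductive LowerGenerated : UNeg (orth n) → Prop
  | cartan (p : UNeg (cartan n)) : LowerGenerated (cartanHom (cartan n) p)
  | ideal (w : UNeg (orth n)) (hw : w ∈ upperIdeal n) : LowerGenerated w
  | lower (i j : Fin (2 * n)) (hij : j < i) (r : ℤ) (hr : r < 0) (w : UNeg (orth n))
      (hw : LowerGenerated w) : LowerGenerated (uElt (F i j) r hr * w)

theorem uElt_mem_of_F {S : Submodule ℂ (UNeg (orth n))} {w : UNeg (orth n)} {r : ℤ} {hr : r < 0}
    (h : ∀ i j, uElt (F i j) r hr * w ∈ S) (x : orth n) : uElt x r hr * w ∈ S := by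
  rw [orth_eq_sum x, uElt_smul, uElt_sum, smul_mul_assoc, Finset.sum_mul]
  refine S.smul_mem _ (S.sum_mem fun i _ => ?_)
  rw [uElt_sum, Finset.sum_mul]
  refine S.sum_mem fun j _ => ?_
  rw [uElt_smul, smul_mul_assoc]
  exact S.smul_mem _ (h i j)

/-- Write `x y w = y x w + [x, y] w` for a lower triangular `y`. The induction hypothesis on `w` is
quantified over all `x` and `r`, so it applies to the bracket as well, of whatever shape it is. -/
theorem LowerGenerated.uElt_mul_mem {w : UNeg (orth n)} (hw : LowerGenerated n w) (x : orth n)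
    (r : ℤ) (hr : r < 0) : uElt x r hr * w ∈ Submodule.span ℂ {w | LowerGenerated n w} := by
  induction hw generalizing x r with
  | cartan p =>
    refine uElt_mem_of_F (fun i j => ?_) x
    rcases lt_trichotomy i j with hij | rfl | hij
    · exact Submodule.subset_span (LowerGenerated.ideal _ (upperIdeal_mul_cartanHom
        (uElt_mem_upperIdeal hij r hr) p))
    · have e := map_mul (cartanHom (AffinePfaffian.cartan n))
        (uElt ⟨F i i, F_mem_cartan n i⟩ r hr) p
      rw [cartanHom_uElt] at e
      rw [← e]
      exact Submodule.subset_span (LowerGenerated.cartan _)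
    · exact Submodule.subset_span (LowerGenerated.lower i j hij r hr _ (.cartan p))
  | ideal w hw =>
    exact Submodule.subset_span (LowerGenerated.ideal _ ((upperIdeal n).mul_mem_left _ hw))
  | lower i j hij s hs w hw ih =>
    rw [← mul_assoc, uElt_mul, add_mul, mul_assoc]
    refine add_mem ?_ (ih _ _ _)
    exact mul_mem_of_mem_span
      (fun v hv => Submodule.subset_span (LowerGenerated.lower i j hij s hs v hv)) (ih x r hr)

theorem triangularSum_eq_top : triangularSum n = ⊤ := by
  have htop : Submodule.span ℂ {w | LowerGenerated n w} = ⊤ := by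
    apply submodule_eq_top
    · rw [← map_one (cartanHom (cartan n))]
      exact Submodule.subset_span (LowerGenerated.cartan 1)
    · intro x r hr s hs
      exact mul_mem_of_mem_span (fun v hv => LowerGenerated.uElt_mul_mem hv x r hr) hs
  rw [eq_top_iff, ← htop, Submodule.span_le]
  intro w hw
  induction hw with
  | cartan p => exact Submodule.mem_sup_left ⟨p, rfl⟩
  | ideal w hw => exact Submodule.mem_sup_right (Submodule.mem_sup_left hw)
  | lower i j hij r hr w _ ih => exact lower_mul_mem_triangularSum hij r hr ih

/-- With `u = p + b + v`, the grading derivation `D` kills `u` and `p`, hence `b + v`. Choose `q`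
with `q(D) v = 0` and `q(0) ≠ 0`; then `q(0)(b + v) = q(D) b` lies in the ideal, which `D`
preserves. The sum need not be direct. -/
theorem exists_sub_cartanHom_mem {u : UNeg (orth n)} (hu : u ∈ invariants (cartan n)) :
    ∃ p : UNeg (cartan n), u - cartanHom (cartan n) p ∈ upperIdeal n := by
  have hmem : u ∈ triangularSum n := by rw [triangularSum_eq_top]; trivial
  obtain ⟨_, ⟨p, rfl⟩, w, hw, rfl⟩ := Submodule.mem_sup.1 hmem
  obtain ⟨b, hb, v, hv, rfl⟩ := Submodule.mem_sup.1 hw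
  refine ⟨p, ?_⟩
  change cartanHom (cartan n) p + (b + v) - cartanHom (cartan n) p ∈ upperIdeal n
  rw [add_sub_cancel_left]
  have hDp : envDer (constDer (gradingElt n)) (cartanHom (cartan n) p) = 0 :=
    cartanHom_mem (cartan n) p _ (gradingElt_mem n)
  have hDw : envDer (constDer (gradingElt n)) (b + v) = 0 := by
    have h : envDer (constDer (gradingElt n)) (cartanHom (cartan n) p + (b + v)) = 0 :=
      hu _ (gradingElt_mem n)
    rwa [map_add, hDp, zero_add] at h
  obtain ⟨q, hq, hqv⟩ := exists_aeval_eq_zero _ hv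
  have h1 := aeval_apply_of_apply_eq_zero _ hDw q
  have h2 := aeval_apply_mem (envDer (constDer (gradingElt n)))
    (S := (upperIdeal n).restrictScalars ℂ)
    (fun w hw => envDer_mem_upperIdeal (gradingElt_mem n) hw) hb q
  rw [map_add, hqv, add_zero] at h1
  rw [h1] at h2
  have h3 := Submodule.smul_mem ((upperIdeal n).restrictScalars ℂ) (q.coeff 0)⁻¹ h2
  rwa [inv_smul_smul₀ hq] at h3

end Triangular

/-! ### Fermionic Fock modules -/

section Fock

variable {κ : Type}

/-- Contraction with a coordinate on the exterior algebra. -/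
def annihilation (p : κ) : Module.End ℂ (ExteriorAlgebra ℂ (κ → ℂ)) :=
  CliffordAlgebra.contractLeft (Q := (0 : QuadraticForm ℂ (κ → ℂ))) (LinearMap.proj p)

theorem annihilation_mul_annihilation (p q : κ) :
    annihilation p * annihilation q = -(annihilation q * annihilation p) := by
  refine LinearMap.ext fun w => ?_
  exact CliffordAlgebra.contractLeft_comm (Q := (0 : QuadraticForm ℂ (κ → ℂ))) _ _ w

variable [DecidableEq κ]

/-- Left multiplication by a basis vector on the exterior algebra. -/
def creation (p : κ) : Module.End ℂ (ExteriorAlgebra ℂ (κ → ℂ)) :=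
  LinearMap.mulLeft ℂ (ExteriorAlgebra.ι ℂ (Pi.single p 1 : κ → ℂ))

theorem creation_mul_creation (p q : κ) :
    creation p * creation q = -(creation q * creation p) := by
  refine LinearMap.ext fun w => ?_
  have h := ExteriorAlgebra.ι_add_mul_swap (R := ℂ) (Pi.single p 1 : κ → ℂ)
    (Pi.single q 1)
  change ExteriorAlgebra.ι ℂ (Pi.single p 1 : κ → ℂ) * (ExteriorAlgebra.ι ℂ (Pi.single q 1) * w) =
    -(ExteriorAlgebra.ι ℂ (Pi.single q 1) * (ExteriorAlgebra.ι ℂ (Pi.single p 1) * w))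
  rw [← mul_assoc, ← mul_assoc, ← neg_mul, eq_neg_of_add_eq_zero_left h]

theorem annihilation_mul_creation (p q : κ) :
    annihilation p * creation q = (if p = q then 1 else 0) - creation q * annihilation p := by
  refine LinearMap.ext fun w => ?_
  have h := CliffordAlgebra.contractLeft_ι_mul (Q := (0 : QuadraticForm ℂ (κ → ℂ)))
    (d := LinearMap.proj p) (Pi.single q 1) w
  refine h.trans ?_
  rw [LinearMap.sub_apply]
  congr 1
  rw [LinearMap.proj_apply, Pi.single_apply]
  split_ifs <;> simp

/-- The vector is the product of the basis vectors in `S`: occupied states cannot be created again,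
empty ones cannot be annihilated. -/
theorem exists_vacuum (S : Finset κ) : ∃ v : ExteriorAlgebra ℂ (κ → ℂ), v ≠ 0 ∧
    (∀ p ∈ S, creation p v = 0) ∧ ∀ p ∉ S, annihilation p v = 0 := by
  induction S using Finset.induction_on with
  | empty =>
    refine ⟨1, ?_, by simp, fun p _ =>
      CliffordAlgebra.contractLeft_one (Q := (0 : QuadraticForm ℂ (κ → ℂ))) _⟩
    intro h
    have := congrArg ExteriorAlgebra.algebraMapInv h
    simp at this
  | insert p S hp ih =>
    obtain ⟨v, hv, h1, h2⟩ := ih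
    have ha : ∀ q ≠ p, ∀ w, annihilation q (creation p w) = -creation p (annihilation q w) := by
      intro q hq w
      have := LinearMap.congr_fun (annihilation_mul_creation q p) w
      simpa [hq] using this
    refine ⟨creation p v, ?_, ?_, ?_⟩
    -- Contraction with the coordinate `p` recovers `v` from `creation p v`, which is why the new
    -- vector is nonzero.
    · intro h0
      have := LinearMap.congr_fun (annihilation_mul_creation p p) v
      simp [h0, h2 p hp] at this
      exact hv this.symm
    · intro q hq
      have := LinearMap.congr_fun (creation_mul_creation q p) v
      rw [Module.End.mul_apply, LinearMap.neg_apply, Module.End.mul_apply] at this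
      rcases Finset.mem_insert.1 hq with rfl | hq
      · have h2 : (2 : ℂ) • creation q (creation q v) = 0 := by
          rw [two_smul]; nth_rw 1 [this]; exact neg_add_cancel _
        exact (smul_eq_zero.1 h2).resolve_left two_ne_zero
      · rw [this, h1 q hq, map_zero, neg_zero]
    · intro q hq
      rw [Finset.mem_insert, not_or] at hq
      rw [ha q hq.1, h2 q hq.2, map_zero, neg_zero]

variable [Fintype κ]

/-- The action of matrices on the exterior algebra by derivations. -/
def fockHom : Matrix κ κ ℂ →ₗ⁅ℂ⁆ Module.End ℂ (ExteriorAlgebra ℂ (κ → ℂ)) where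
  toFun Y := ∑ x : κ × κ, Y x.1 x.2 • (creation x.1 * annihilation x.2)
  map_add' X Y := by simp [add_smul, Finset.sum_add_distrib]
  map_smul' c Y := by simp [mul_smul, Finset.smul_sum]
  map_lie' {X Y} := by
    -- The anticommutation relations bring both products to the same quartic term, which cancels;
    -- the contractions reproduce the commutator of matrix units.
    have key : ∀ p q r s : κ, (creation p * annihilation q) * (creation r * annihilation s) -
        (creation r * annihilation s) * (creation p * annihilation q) =
        (if q = r then (1 : ℂ) else 0) • (creation p * annihilation s) -
          (if p = s then (1 : ℂ) else 0) • (creation r * annihilation q) := by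
      intro p q r s
      have e1 : (creation p * annihilation q) * (creation r * annihilation s) =
          (if q = r then (1 : ℂ) else 0) • (creation p * annihilation s) -
            creation p * creation r * annihilation q * annihilation s := by
        rw [show (creation p * annihilation q) * (creation r * annihilation s) =
          creation p * (annihilation q * creation r) * annihilation s by noncomm_ring,
          annihilation_mul_creation]
        split_ifs <;> simp [mul_sub, sub_mul, mul_assoc]
      have e2 : (creation r * annihilation s) * (creation p * annihilation q) =
          (if p = s then (1 : ℂ) else 0) • (creation r * annihilation q) -
            creation p * creation r * annihilation q * annihilation s := by
        rw [show (creation r * annihilation s) * (creation p * annihilation q) =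
          creation r * (annihilation s * creation p) * annihilation q by noncomm_ring,
          annihilation_mul_creation, creation_mul_creation p r, neg_mul, neg_mul,
          mul_assoc (creation r * creation p), annihilation_mul_annihilation q s]
        simp only [eq_comm (a := s) (b := p)]
        split_ifs <;> simp [mul_sub, sub_mul, mul_assoc]
      rw [e1, e2]; abel
    rw [LieRing.of_associative_ring_bracket, LieRing.of_associative_ring_bracket]
    have h1 : (∑ x : κ × κ, X x.1 x.2 • (creation x.1 * annihilation x.2)) *
          (∑ y : κ × κ, Y y.1 y.2 • (creation y.1 * annihilation y.2)) -
        (∑ y : κ × κ, Y y.1 y.2 • (creation y.1 * annihilation y.2)) *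
          (∑ x : κ × κ, X x.1 x.2 • (creation x.1 * annihilation x.2)) =
        ∑ x : κ × κ, ∑ y : κ × κ, (X x.1 x.2 * Y y.1 y.2) •
          ((if x.2 = y.1 then (1 : ℂ) else 0) • (creation x.1 * annihilation y.2) -
          (if x.1 = y.2 then (1 : ℂ) else 0) • (creation y.1 * annihilation x.2)) := by
      simp only [← key, smul_sub, Finset.sum_sub_distrib]
      congr 1
      · simp only [Finset.sum_mul_sum, smul_mul_smul_comm]
      · rw [Finset.sum_comm]
        simp only [Finset.sum_mul_sum, smul_mul_smul_comm, mul_comm]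
    rw [h1]
    simp only [smul_sub, Finset.sum_sub_distrib, Matrix.sub_apply, sub_smul, Matrix.mul_apply,
      Finset.sum_smul, Fintype.sum_prod_type, smul_smul]
    congr 1
    · refine Finset.sum_congr rfl fun p _ => ?_
      rw [Finset.sum_comm' (t' := Finset.univ) (s' := fun _ => Finset.univ) (by simp)]
      simp
    · simp
      rw [Finset.sum_comm, Finset.sum_congr rfl (fun _ _ => Finset.sum_comm), Finset.sum_comm]
      simp only [mul_comm]

/-- Moving a state `q` to `p` gives zero if `q` is empty, or if `p ≠ q` is already occupied. `hY`
excludes moves from an occupied to an empty state, so only the occupied diagonal entries contribute.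
-/
theorem fockHom_apply_vacuum {S : Finset κ} {v : ExteriorAlgebra ℂ (κ → ℂ)}
    (h1 : ∀ p ∈ S, creation p v = 0) (h2 : ∀ p ∉ S, annihilation p v = 0) {Y : Matrix κ κ ℂ}
    (hY : ∀ p q, p ≠ q → q ∈ S → p ∉ S → Y p q = 0) :
    fockHom Y v = (∑ p ∈ S, Y p p) • v := by
  have key : ∀ p q, Y p q • creation p (annihilation q v) =
      if p = q then (if p ∈ S then Y p p • v else 0) else 0 := by
    intro p q
    by_cases hq : q ∈ S
    · have h := LinearMap.congr_fun (annihilation_mul_creation q p) v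
      rw [LinearMap.sub_apply, Module.End.mul_apply, Module.End.mul_apply] at h
      by_cases hpq : p = q
      · subst hpq
        rw [h1 p hq, map_zero, if_pos rfl] at h
        rw [if_pos rfl, if_pos hq, ← sub_eq_zero.1 h.symm]; rfl
      · rw [if_neg hpq]
        by_cases hp : p ∈ S
        · rw [h1 p hp, map_zero, if_neg (Ne.symm hpq), LinearMap.zero_apply, zero_sub] at h
          rw [neg_eq_zero.1 h.symm, smul_zero]
        · rw [hY p q hpq hq hp, zero_smul]
    · rw [h2 q hq, map_zero, smul_zero]
      split_ifs with h3 h4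
      · subst h3; exact absurd h4 hq
      · rfl
      · rfl
  change (∑ x : κ × κ, Y x.1 x.2 • (creation x.1 * annihilation x.2)) v = _
  simp only [Fintype.sum_prod_type, LinearMap.sum_apply, LinearMap.smul_apply, Module.End.mul_apply, key]
  simp [Finset.sum_smul]

end Fock

/-! ### Characters of the enveloping algebra of an abelian Lie algebra -/

section Characters

variable {L : Type*} [LieRing L] [LieAlgebra ℂ L] [IsLieAbelian L]

/-- The algebra homomorphism to a commutative algebra extending a linear map on an abelian Lie
algebra. -/
def charHom {A : Type*} [CommRing A] [Algebra ℂ A] (f : L →ₗ[ℂ] A) :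
    UniversalEnvelopingAlgebra ℂ L →ₐ[ℂ] A :=
  UniversalEnvelopingAlgebra.lift ℂ
    { f with
      map_lie' := by
        intro x y
        rw [LieRing.of_associative_ring_bracket, mul_comm, sub_self, trivial_lie_zero]
        exact map_zero f }

theorem charHom_ι {A : Type*} [CommRing A] [Algebra ℂ A] (f : L →ₗ[ℂ] A) (x : L) :
    charHom f (UniversalEnvelopingAlgebra.ι ℂ x) = f x := by
  rw [charHom, UniversalEnvelopingAlgebra.lift_ι_apply]
  rfl

theorem charHom_eq_eval {κ : Type*} (b : Module.Basis κ ℂ L) (f : L →ₗ[ℂ] ℂ)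
    (u : UniversalEnvelopingAlgebra ℂ L) :
    charHom f u = MvPolynomial.eval (fun i => f (b i))
      (charHom (b.constr ℂ fun i => (MvPolynomial.X i : MvPolynomial κ ℂ)) u) := by
  induction u using env_induction with
  | hι x =>
    rw [charHom_ι, charHom_ι]
    have h : f = (MvPolynomial.aeval fun i => f (b i)).toLinearMap ∘ₗ
        b.constr ℂ fun i => (MvPolynomial.X i : MvPolynomial κ ℂ) :=
      b.ext fun i => by simp
    exact LinearMap.congr_fun h x
  | halg c => simp [AlgHom.commutes]
  | hadd u v hu hv => rw [map_add, map_add, map_add, hu, hv]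
  | hmul u v hu hv => rw [map_mul, map_mul, map_mul, hu, hv]

/-- The enveloping algebra of an abelian Lie algebra is commutative, so polynomials in the basis map
back to it; the two homomorphisms compose to the identity on generators. -/
theorem charHom_injective {κ : Type*} (b : Module.Basis κ ℂ L) :
    Function.Injective
      (charHom (b.constr ℂ fun i => (MvPolynomial.X i : MvPolynomial κ ℂ))) := by
  have hcomm : ∀ u v : UniversalEnvelopingAlgebra ℂ L, u * v = v * u := by
    intro u v
    change Commute u v
    induction u using env_induction with
    | hι x =>
      induction v using env_induction with
      | hι y =>
        rw [commute_iff_lie_eq, ← LieHom.map_lie, trivial_lie_zero, map_zero]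
      | halg c => exact (Algebra.commutes c _).symm
      | hadd u v hu hv => exact hu.add_right hv
      | hmul u v hu hv => exact hu.mul_right hv
    | halg c => exact Algebra.commutes c _
    | hadd u v hu hv => exact hu.add_left hv
    | hmul u v hu hv => exact hu.mul_left hv
  let _ : CommRing (UniversalEnvelopingAlgebra ℂ L) :=
    { (inferInstance : Ring (UniversalEnvelopingAlgebra ℂ L)) with mul_comm := hcomm }
  let ψ : MvPolynomial κ ℂ →ₐ[ℂ] UniversalEnvelopingAlgebra ℂ L :=
    MvPolynomial.aeval fun i => UniversalEnvelopingAlgebra.ι ℂ (b i)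
  refine Function.LeftInverse.injective (g := ψ) fun u => ?_
  induction u using env_induction with
  | hι x =>
    rw [charHom_ι]
    have h : ψ.toLinearMap ∘ₗ (b.constr ℂ fun i => (MvPolynomial.X i : MvPolynomial κ ℂ)) =
        (UniversalEnvelopingAlgebra.ι ℂ : L →ₗ⁅ℂ⁆ UniversalEnvelopingAlgebra ℂ L).toLinearMap :=
      b.ext fun i => by simp [ψ, -UniversalEnvelopingAlgebra.ι_apply]
    exact LinearMap.congr_fun h x
  | halg c => rw [AlgHom.commutes, AlgHom.commutes]
  | hadd u v hu hv => rw [map_add, map_add, hu, hv]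
  | hmul u v hu hv => rw [map_mul, map_mul, hu, hv]

/-- View `u` as a polynomial `P` in finitely many coordinates. By separation `G` spans all values of
these coordinates, and `P` vanishes on all combinations of `G` with coefficients in `ℕ`. As `ℕ` is
infinite in `ℂ`, `P` vanishes on all complex combinations too. -/
theorem eq_zero_of_charHom_eq_zero {G : Set (L →ₗ[ℂ] ℂ)} (h0 : 0 ∈ G)
    (hadd : ∀ f ∈ G, ∀ g ∈ G, f + g ∈ G) (hsep : ∀ x : L, (∀ g ∈ G, g x = 0) → x = 0)
    {u : UniversalEnvelopingAlgebra ℂ L} (hu : ∀ g ∈ G, charHom g u = 0) : u = 0 := by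
  let b := Module.Basis.ofVectorSpace ℂ L
  apply charHom_injective b
  rw [map_zero]
  classical
  set P := charHom (b.constr ℂ fun i => (MvPolynomial.X i : MvPolynomial _ ℂ)) u with hP
  have hev : ∀ g ∈ G, MvPolynomial.eval (fun i => g (b i)) P = 0 := fun g hg => by
    rw [hP, ← charHom_eq_eval]; exact hu g hg
  -- Otherwise a nonzero functional `φ` kills the span; it amounts to a nontrivial combination of
  -- the `b i` killed by all of `G`, against `hsep`.
  have hspan : Submodule.span ℂ
      (Set.range fun (g : G) (i : P.vars) => (g : L →ₗ[ℂ] ℂ) (b i)) = ⊤ := by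
    by_contra hne
    obtain ⟨φ, hφ, hφG⟩ := Submodule.exists_dual_map_eq_bot_of_lt_top (lt_top_iff_ne_top.2 hne)
      inferInstance
    apply hφ
    have hx : ∑ i : P.vars, φ (Pi.single i 1) • b i = 0 := by
      apply hsep
      intro g hg
      have : φ (fun i : P.vars => g (b i)) = 0 := by
        have : φ (fun i : P.vars => g (b i)) ∈ (⊥ : Submodule ℂ ℂ) := by
          rw [← hφG]
          exact Submodule.mem_map_of_mem (Submodule.subset_span ⟨⟨g, hg⟩, rfl⟩)
        simpa using this
      rw [← this, map_sum, LinearMap.pi_apply_eq_sum_univ φ]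
      refine Finset.sum_congr rfl fun i _ => ?_
      rw [map_smul, smul_eq_mul, smul_eq_mul, mul_comm]
      congr 2
      ext j
      simp [Pi.single_apply, eq_comm]
    have hli := (Fintype.linearIndependent_iff.1
      (b.linearIndependent.comp (Subtype.val : P.vars → _) Subtype.val_injective)) _ hx
    refine LinearMap.pi_ext' fun i => ?_
    ext
    simpa using hli i
  apply MvPolynomial.funext
  intro c
  have hc : (fun i : P.vars => c i) ∈ Submodule.span ℂ
      (Set.range fun (g : G) (i : P.vars) => (g : L →ₗ[ℂ] ℂ) (b i)) := by
    rw [hspan]; trivial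
  obtain ⟨s, hs⟩ := Finsupp.mem_span_range_iff_exists_finsupp.1 hc
  -- `Q` is `P` pulled back along the coefficients of a linear combination of the elements of
  -- `s.support`; it vanishes at natural-number points because `G` is closed under addition.
  let Q : MvPolynomial G ℂ := MvPolynomial.bind₁
    (fun i => ∑ g ∈ s.support, MvPolynomial.C ((g : L →ₗ[ℂ] ℂ) (b i)) * MvPolynomial.X g) P
  have hQ : ∀ t : G → ℂ, MvPolynomial.eval t Q =
      MvPolynomial.eval (fun i => ∑ g ∈ s.support, t g * (g : L →ₗ[ℂ] ℂ) (b i)) P := by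
    intro t
    simp only [Q]
    rw [MvPolynomial.eval, MvPolynomial.eval₂Hom_bind₁]
    refine MvPolynomial.eval₂Hom_congr' rfl (fun i _ _ => ?_) rfl
    simp [mul_comm]
  have hQ0 : Q = 0 := by
    refine MvPolynomial.funext_set (fun _ => Set.range (Nat.cast : ℕ → ℂ))
      (fun _ => Set.infinite_range_of_injective Nat.cast_injective) fun t ht => ?_
    rw [hQ, map_zero]
    choose m hm using fun g => ht g (Set.mem_univ g)
    have hmem : ∑ g ∈ s.support, m g • (g : L →ₗ[ℂ] ℂ) ∈ G := by
      let S : AddSubmonoid (L →ₗ[ℂ] ℂ) :=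
        { carrier := G, zero_mem' := h0, add_mem' := fun ha hb => hadd _ ha _ hb }
      exact sum_mem (S := S) fun g _ => nsmul_mem (show (g : L →ₗ[ℂ] ℂ) ∈ S from g.2) _
    have := hev _ hmem
    simpa [LinearMap.sum_apply, ← hm] using this
  have := hQ s
  rw [hQ0, map_zero] at this
  rw [map_zero, this]
  refine MvPolynomial.eval₂Hom_congr' rfl (fun i hi _ => ?_) rfl
  have := congrFun hs ⟨i, hi⟩
  simpa [Finsupp.sum] using this.symm

end Characters

/-! ### Evaluation modules -/

section Evaluation

variable {g : Type*} [LieRing g] [LieAlgebra ℂ g]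

/-- The evaluation `x[r] ↦ zʳ x` on the loop algebra. -/
def loopEval (z : ℂˣ) : Loop g →ₗ[ℂ] g :=
  Finsupp.lsum ℂ (fun r : ℤ => ((z ^ r : ℂˣ) : ℂ) • (LinearMap.id : g →ₗ[ℂ] g)) ∘ₗ
    (LieAlgebra.LoopAlgebra.toFinsupp ℂ ℤ g).toLinearMap

theorem loopEval_loopElt (z : ℂˣ) (x : g) (r : ℤ) :
    loopEval z (loopElt x r) = ((z ^ r : ℂˣ) : ℂ) • x := by
  have h : LieAlgebra.LoopAlgebra.toFinsupp ℂ ℤ g (loopElt x r) = Finsupp.single r x :=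
    LieAlgebra.LoopAlgebra.toFinsupp_single_tmul ℂ ℤ g r x
  change Finsupp.lsum ℂ _ (LieAlgebra.LoopAlgebra.toFinsupp ℂ ℤ g (loopElt x r)) = _
  rw [h]
  simp

/-- The characters `z ↦ z ^ r` of `ℂˣ` are distinct, hence linearly independent. Applying a
functional `ψ` on `g` reduces to scalar Laurent polynomials. -/
theorem eq_zero_of_loopEval_eq_zero {x : Loop g} (hx : ∀ z : ℂˣ, loopEval z x = 0) : x = 0 := by
  refine (LieAlgebra.LoopAlgebra.toFinsupp ℂ ℤ g).map_eq_zero_iff.1 ?_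
  set f := LieAlgebra.LoopAlgebra.toFinsupp ℂ ℤ g x with hf
  have hx' : ∀ z : ℂˣ, f.sum (fun r y => ((z ^ r : ℂˣ) : ℂ) • y) = 0 := hx
  have hinj : Function.Injective fun r : ℤ => ((Units.coeHom ℂ).comp (zpowGroupHom r) : ℂˣ →* ℂ) := by
    intro r s hrs
    -- Powers of `2` already distinguish the exponents.
    have := DFunLike.congr_fun hrs (Units.mk0 (2 : ℂ) two_ne_zero)
    simp only [MonoidHom.comp_apply, zpowGroupHom_apply, Units.coeHom_apply, Units.val_zpow_eq_zpow_val,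
      Units.val_mk0] at this
    have h2 := congrArg norm this
    rw [norm_zpow, norm_zpow] at h2
    exact zpow_right_injective₀ (by norm_num) (by norm_num) h2
  have hli := (linearIndependent_monoidHom ℂˣ ℂ).comp _ hinj
  ext r
  rw [Finsupp.zero_apply, ← Module.forall_dual_apply_eq_zero_iff ℂ]
  intro ψ
  have h0 : f.mapRange ψ (map_zero ψ) = 0 := by
    apply (linearIndependent_iff.1 hli)
    funext z
    rw [Finsupp.linearCombination_apply, Finsupp.sum_mapRange_index (by simp)]
    have := congrArg ψ (hx' z)
    rw [Finsupp.sum, map_sum, map_zero] at this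
    rw [Finsupp.sum, Finset.sum_apply, Pi.zero_apply, ← this]
    refine Finset.sum_congr rfl fun s _ => ?_
    simp [mul_comm]
  simpa using DFunLike.congr_fun h0 r

/-- The action of `t⁻¹ o_{2n}[t⁻¹]` on the exterior algebra of a sum of evaluation modules. -/
def fockRep {n : ℕ} {M : Type} [Fintype M] [DecidableEq M] (z : M → ℂˣ) :
    negLoop (orth n) →ₗ⁅ℂ⁆ Module.End ℂ (ExteriorAlgebra ℂ (Fin (2 * n) × M → ℂ)) :=
  fockHom.comp
    { toFun := fun x => Matrix.blockDiagonal fun m =>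
        ((loopEval (z m) (x : Loop (orth n)) : orth n) : Matrix (Fin (2 * n)) (Fin (2 * n)) ℂ)
      map_add' := fun x y => by
        rw [← Matrix.blockDiagonal_add]
        congr 1
        funext m
        change ((loopEval (z m) ((x : Loop (orth n)) + y) : orth n) :
          Matrix (Fin (2 * n)) (Fin (2 * n)) ℂ) = _
        rw [map_add]
        rfl
      map_smul' := fun c x => by
        rw [RingHom.id_apply, ← Matrix.blockDiagonal_smul]
        congr 1
        funext m
        change ((loopEval (z m) (c • (x : Loop (orth n))) : orth n) :
          Matrix (Fin (2 * n)) (Fin (2 * n)) ℂ) = _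
        rw [map_smul]
        rfl
      map_lie' := fun {x y} => by
        have key : ∀ w : ℂˣ, loopEval w ⁅(x : Loop (orth n)), (y : Loop (orth n))⁆ =
            ⁅loopEval w (x : Loop (orth n)), loopEval w (y : Loop (orth n))⁆ := by
          intro w
          refine negLoop_induction (p := fun a => loopEval w ⁅a, (y : Loop (orth n))⁆ =
            ⁅loopEval w a, loopEval w (y : Loop (orth n))⁆) ?_ ?_ ?_ ?_ x
          · intro a r hr
            refine negLoop_induction (p := fun b => loopEval w ⁅loopElt a r, b⁆ =
              ⁅loopEval w (loopElt a r), loopEval w b⁆) ?_ ?_ ?_ ?_ y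
            · intro b s hs
              rw [lie_loopElt, loopEval_loopElt, loopEval_loopElt, loopEval_loopElt, smul_lie,
                lie_smul, smul_smul, zpow_add, Units.val_mul]
            · simp
            · intro a b ha hb
              simp only [lie_add, map_add, ha, hb]
            · intro c a ha
              simp only [lie_smul, map_smul, ha]
          · simp
          · intro a b ha hb
            simp only [add_lie, map_add, ha, hb]
          · intro c a ha
            simp only [smul_lie, map_smul, ha]
        rw [LieRing.of_associative_ring_bracket, ← Matrix.blockDiagonal_mul,
          ← Matrix.blockDiagonal_mul, ← Matrix.blockDiagonal_sub]
        congr 1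
        funext m
        change ((loopEval (z m) ⁅(x : Loop (orth n)), (y : Loop (orth n))⁆ : orth n) :
          Matrix (Fin (2 * n)) (Fin (2 * n)) ℂ) = _
        rw [key]
        rfl }

theorem lift_fockRep_uElt {n : ℕ} {M : Type} [Fintype M] [DecidableEq M] (z : M → ℂˣ)
    (x : orth n) (r : ℤ) (hr : r < 0) :
    UniversalEnvelopingAlgebra.lift ℂ (fockRep z) (uElt x r hr) =
      fockHom (Matrix.blockDiagonal fun m => ((z m ^ r : ℂˣ) : ℂ) •
        (x : Matrix (Fin (2 * n)) (Fin (2 * n)) ℂ)) := by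
  rw [uElt, UniversalEnvelopingAlgebra.lift_ι_apply]
  change fockHom (Matrix.blockDiagonal fun m =>
    ((loopEval (z m) (loopElt x r) : orth n) : Matrix (Fin (2 * n)) (Fin (2 * n)) ℂ)) = _
  simp only [loopEval_loopElt]
  rfl

/-- The sum of the values at `z` of the first `k` diagonal entries. -/
def weightFun {n : ℕ} (k : ℕ) (z : ℂˣ) : negLoop (cartan n) →ₗ[ℂ] ℂ :=
  (∑ i ∈ Finset.univ.filter (fun i : Fin (2 * n) => (i : ℕ) < k),
    Matrix.entryLinearMap ℂ ℂ i i ∘ₗ (orth n).toSubmodule.subtype ∘ₗ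
      (cartan n).toSubmodule.subtype) ∘ₗ loopEval z ∘ₗ (negLoop (cartan n)).toSubmodule.subtype

theorem weightFun_apply {n : ℕ} (k : ℕ) (z : ℂˣ) (x : negLoop (cartan n)) :
    weightFun k z x = ∑ i ∈ Finset.univ.filter (fun i : Fin (2 * n) => (i : ℕ) < k),
      (((loopEval z (x : Loop (cartan n)) : cartan n) : orth n) :
        Matrix (Fin (2 * n)) (Fin (2 * n)) ℂ) i i := by
  rw [weightFun, LinearMap.comp_apply, LinearMap.sum_apply]
  rfl

instance {h : Type*} [LieRing h] [LieAlgebra ℂ h] [IsLieAbelian h] : IsLieAbelian (negLoop h) where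
  trivial a b := by
    apply Subtype.ext
    change ⁅(a : Loop h), (b : Loop h)⁆ = 0
    refine negLoop_induction (p := fun a => ⁅a, (b : Loop h)⁆ = 0) ?_ ?_ ?_ ?_ a
    · intro x r hr
      refine negLoop_induction (p := fun b => ⁅loopElt x r, b⁆ = 0) ?_ ?_ ?_ ?_ b
      · intro y s hs
        rw [lie_loopElt, trivial_lie_zero, loopElt_zero]
      · simp
      · intro a b ha hb; rw [lie_add, ha, hb, add_zero]
      · intro c a ha; rw [lie_smul, ha, smul_zero]
    · simp
    · intro a b ha hb; rw [add_lie, ha, hb, add_zero]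
    · intro c a ha; rw [smul_lie, ha, smul_zero]

theorem apply_eq_smul {E : Type*} [AddCommGroup E] [Module ℂ E] (φ : UNeg g →ₐ[ℂ] Module.End ℂ E)
    (χ : UNeg g →ₐ[ℂ] ℂ) (v : E)
    (h : ∀ (x : g) (r : ℤ) (hr : r < 0), φ (uElt x r hr) v = χ (uElt x r hr) • v) (u : UNeg g) :
    φ u v = χ u • v := by
  induction u using uNeg_induction with
  | helt x r hr => exact h x r hr
  | halg c => rw [AlgHom.commutes, AlgHom.commutes]; rfl
  | hadd a b ha hb => rw [map_add, map_add, LinearMap.add_apply, ha, hb, add_smul]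
  | hmul a b ha hb =>
    rw [map_mul, map_mul, Module.End.mul_apply, hb, map_smul, ha, smul_smul, mul_comm]

/-- At the evaluation point `z m` the first `k m` states are occupied. Upper triangular elements
only move states to earlier, already occupied ones, so the vacuum is a highest weight vector killed
by the ideal. On it `p` acts by the character, which must therefore vanish on `p`. -/
theorem charHom_eq_zero_of_mem {n : ℕ} {M : Type} [Fintype M] [DecidableEq M] (z : M → ℂˣ)
    (k : M → ℕ) {p : UNeg (cartan n)} (hp : cartanHom (cartan n) p ∈ upperIdeal n) :
    charHom (∑ m, weightFun (k m) (z m)) p = 0 := by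
  let S : Finset (Fin (2 * n) × M) := Finset.univ.filter fun x => (x.1 : ℕ) < k x.2
  obtain ⟨v, hv, h1, h2⟩ := exists_vacuum S
  have hI : ∀ w ∈ upperIdeal n, UniversalEnvelopingAlgebra.lift ℂ (fockRep z) w v = 0 := by
    intro w hw
    refine upperIdeal_induction
      (p := fun w => UniversalEnvelopingAlgebra.lift ℂ (fockRep z) w v = 0) ?_ ?_ ?_ ?_ hw
    · intro i j r hr hij
      have hF : ∀ a b : Fin (2 * n), b ≤ a →
          ((F i j : orth n) : Matrix (Fin (2 * n)) (Fin (2 * n)) ℂ) a b = 0 := by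
        intro a b hab
        have h3 := Fin.rev_lt_rev.2 hij
        rw [F_coe, Matrix.sub_apply, Matrix.single_apply, Matrix.single_apply, if_neg, if_neg,
          sub_zero]
        · rintro ⟨rfl, rfl⟩; exact absurd hab (not_le.2 h3)
        · rintro ⟨rfl, rfl⟩; exact absurd hab (not_le.2 hij)
      rw [lift_fockRep_uElt, fockHom_apply_vacuum h1 h2]
      · rw [Finset.sum_eq_zero, zero_smul]
        rintro ⟨a, m⟩ _
        simp [Matrix.blockDiagonal_apply, hF a a le_rfl]
      · rintro ⟨a, m⟩ ⟨b, m'⟩ _ hb ha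
        rw [Matrix.blockDiagonal_apply]
        split_ifs with hm
        · obtain rfl : m = m' := hm
          have ha' : ¬ (a : ℕ) < k m := fun h => ha (by simp [S, h])
          have hb' : (b : ℕ) < k m := by simpa [S] using hb
          have : b ≤ a := by rw [Fin.le_def]; omega
          simp [hF a b this]
        · rfl
    · rw [map_zero, LinearMap.zero_apply]
    · intro a b ha hb; rw [map_add, LinearMap.add_apply, ha, hb, add_zero]
    · intro a b _ hb; rw [map_mul, Module.End.mul_apply, hb, map_zero]
  have hH := apply_eq_smul ((UniversalEnvelopingAlgebra.lift ℂ (fockRep z)).comp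
    (cartanHom (cartan n))) (charHom (∑ m, weightFun (k m) (z m))) v (fun x r hr => by
      obtain ⟨c, hc⟩ := cartan_diagonal x.2
      rw [AlgHom.comp_apply, cartanHom_uElt, lift_fockRep_uElt, fockHom_apply_vacuum h1 h2]
      · congr 1
        rw [uElt, charHom_ι, LinearMap.sum_apply]
        simp only [weightFun_apply]
        have : ∀ w : ℂˣ, loopEval w ((negElt x r hr : negLoop (cartan n)) : Loop (cartan n)) =
          ((w ^ r : ℂˣ) : ℂ) • x := fun w => loopEval_loopElt w x r
        simp only [this]
        rw [Finset.sum_filter, Fintype.sum_prod_type_right]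
        refine Finset.sum_congr rfl fun m _ => ?_
        rw [Finset.sum_filter]
        refine Finset.sum_congr rfl fun i _ => ?_
        simp only [Matrix.blockDiagonal_apply, if_true]
        rfl
      · rintro ⟨a, m⟩ ⟨b, m'⟩ hab hb ha
        rw [Matrix.blockDiagonal_apply]
        split_ifs with hm
        · obtain rfl : m = m' := hm
          have : a ≠ b := fun h => hab (by rw [h])
          simp [hc, Matrix.diagonal_apply_ne _ this]
        · rfl)
  exact (smul_eq_zero.1 ((hH p).symm.trans (hI _ hp))).resolve_right hv

/-- Disjoint unions of parameter sets add the characters, so arbitrary finite families `M` are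
needed for closure under addition. -/
theorem eq_zero_of_cartanHom_mem {n : ℕ} {p : UNeg (cartan n)}
    (hp : cartanHom (cartan n) p ∈ upperIdeal n) : p = 0 := by
  refine eq_zero_of_charHom_eq_zero (G := {f | ∃ (M : Type) (_ : Fintype M) (z : M → ℂˣ)
    (k : M → ℕ), f = ∑ m, weightFun (k m) (z m)}) ?_ ?_ ?_ ?_
  · exact ⟨Empty, inferInstance, Empty.elim, Empty.elim, by simp⟩
  · rintro _ ⟨M, _, z, k, rfl⟩ _ ⟨M', _, z', k', rfl⟩
    exact ⟨M ⊕ M', inferInstance, Sum.elim z z', Sum.elim k k', by simp⟩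
  · intro x hx
    apply Subtype.ext
    apply eq_zero_of_loopEval_eq_zero
    intro z
    have h0 : ∀ k, weightFun k z x = 0 := fun k =>
      hx _ ⟨Unit, inferInstance, fun _ => z, fun _ => k, by simp⟩
    apply Subtype.ext
    apply Subtype.ext
    obtain ⟨c, hc⟩ := cartan_diagonal (loopEval z (x : Loop (cartan n))).2
    rw [hc]
    have hdiag : ∀ i, c i = 0 := by
      intro i
      -- The weights for `i + 1` and `i` occupied states differ by the `i`-th diagonal entry alone.
      have h1 := h0 (i + 1)
      have h2 := h0 i
      rw [weightFun_apply] at h1 h2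
      have : Finset.univ.filter (fun j : Fin (2 * n) => (j : ℕ) < i + 1) =
          insert i (Finset.univ.filter (fun j : Fin (2 * n) => (j : ℕ) < i)) := by
        ext j
        simp only [Finset.mem_filter, Finset.mem_univ, true_and, Finset.mem_insert, Fin.ext_iff]
        omega
      rw [this, Finset.sum_insert (by simp), h2, add_zero, hc, Matrix.diagonal_apply_eq] at h1
      exact h1
    rw [show c = 0 from funext hdiag]
    simp
  · rintro _ ⟨M, _, z, k, rfl⟩
    classical
    exact charHom_eq_zero_of_mem z k hp

theorem existsUnique_isHarishChandra (n : ℕ) :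
    ∃! χ : invariants (cartan n) →ₐ[ℂ] UNeg (cartan n),
      IsHarishChandra (cartan n) (upperIdeal n) χ :=
  existsUnique_harishChandra (fun _ hu => exists_sub_cartanHom_mem hu)
    (fun _ hp => eq_zero_of_cartanHom_mem hp) (fun _ hw p => upperIdeal_mul_cartanHom hw p)

end Evaluation

/-! ### Quadratic forms with Grassmann variables -/

section Grassmann

variable {n : ℕ} {W : Type*} [Ring W] [Algebra ℂ W]

/-- Anticommuting variables that commute with the image of the enveloping algebra. -/
structure IsGrassmann (x : Fin (2 * n) → W) (φ : UNeg (orth n) →ₐ[ℂ] W) : Prop where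
  anti : ∀ i j, x i * x j = -(x j * x i)
  comm : ∀ i u, Commute (x i) (φ u)

/-- The linear form `∑_b x_b F_{c,-b}[r]`. -/
def linForm (x : Fin (2 * n) → W) (φ : UNeg (orth n) →ₐ[ℂ] W) (T : Finset (Fin (2 * n)))
    (c : Fin (2 * n)) (r : ℤ) (hr : r < 0) : W :=
  ∑ b ∈ T, x b * φ (uElt (F c b.rev) r hr)

/-- The quadratic form `½ ∑_{a,b} x_a x_b F_{a,-b}[r]`. -/
def quadForm (x : Fin (2 * n) → W) (φ : UNeg (orth n) →ₐ[ℂ] W) (T : Finset (Fin (2 * n)))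
    (r : ℤ) (hr : r < 0) : W :=
  (2⁻¹ : ℂ) • ∑ a ∈ T, x a * linForm x φ T a r hr

variable {x : Fin (2 * n) → W} {φ : UNeg (orth n) →ₐ[ℂ] W}

theorem eq_zero_of_eq_neg_self {w : W} (h : w = -w) : w = 0 := by
  have h2 : (2 : ℂ) • w = 0 := by
    rw [two_smul]; nth_rw 1 [h]; exact neg_add_cancel _
  exact (smul_eq_zero.1 h2).resolve_left two_ne_zero

omit [Algebra ℂ W] in
theorem mul_mul_of_commute {a b c f g : W} (h1 : Commute b f) (h2 : Commute c f) :
    (a * f) * (b * (c * g)) = a * b * c * (f * g) := by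
  rw [mul_assoc a, ← mul_assoc f, ← h1.eq, mul_assoc b, ← mul_assoc f, ← h2.eq]
  simp only [mul_assoc]

omit [Algebra ℂ W] in
theorem mul_mul_of_commute' {a b c f g : W} (h1 : Commute a g) (h2 : Commute a (b * c)) :
    (b * (c * g)) * (a * f) = a * b * c * (g * f) := by
  rw [← mul_assoc b, mul_assoc (b * c), ← mul_assoc g, ← h1.eq, mul_assoc a,
    ← mul_assoc (b * c) a, ← h2.eq]
  simp only [mul_assoc]

omit [Algebra ℂ W] in
theorem mul_mul_of_commute₂ {a b f g : W} (h : Commute b f) :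
    (a * f) * (b * g) = a * b * (f * g) := by
  rw [mul_assoc a, ← mul_assoc f, ← h.eq]
  simp only [mul_assoc]

theorem map_uElt_lie (a b : orth n) (r s : ℤ) (hr : r < 0) (hs : s < 0) :
    φ (uElt a r hr) * φ (uElt b s hs) - φ (uElt b s hs) * φ (uElt a r hr) =
      φ (uElt ⁅a, b⁆ (r + s) (by omega)) := by
  rw [← uElt_lie a b r s hr hs, map_sub, map_mul, map_mul]

theorem map_bracket_F (c b i j : Fin (2 * n)) (r : ℤ) (hr : r < 0) :
    φ (uElt ⁅F c b, F i j⁆ r hr) =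
      (if b = i then (1 : ℂ) else 0) • φ (uElt (F c j) r hr) -
      (if c = j then (1 : ℂ) else 0) • φ (uElt (F i b) r hr) -
      (if c.rev = i then (1 : ℂ) else 0) • φ (uElt (F b.rev j) r hr) +
      (if b.rev = j then (1 : ℂ) else 0) • φ (uElt (F i c.rev) r hr) := by
  rw [lie_F_F]
  simp only [← uLin_apply, map_add, map_sub, map_smul]

namespace IsGrassmann

variable (h : IsGrassmann x φ)
include h

theorem sq (i : Fin (2 * n)) : x i * x i = 0 := eq_zero_of_eq_neg_self (h.anti i i)

theorem commute_pair (i j k : Fin (2 * n)) : Commute (x i) (x j * x k) := by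
  rw [commute_iff_eq, ← mul_assoc, h.anti i j, neg_mul, mul_assoc, h.anti i k, mul_neg, neg_neg,
    mul_assoc]

/-- Reindexing by `a ↦ a.rev` swaps the two anticommuting factors, so the sum is its own negative.
-/
theorem sum_mul_rev {T : Finset (Fin (2 * n))} (hT : ∀ a ∈ T, a.rev ∈ T) :
    ∑ a ∈ T, x a * x a.rev = 0 := by
  apply eq_zero_of_eq_neg_self
  rw [← Finset.sum_neg_distrib]
  refine Finset.sum_bij' (fun a _ => a.rev) (fun a _ => a.rev) hT hT (fun a _ => a.rev_rev)
    (fun a _ => a.rev_rev) fun a _ => ?_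
  rw [Fin.rev_rev, ← h.anti]

theorem sum_rev_mul {T : Finset (Fin (2 * n))} (hT : ∀ a ∈ T, a.rev ∈ T) :
    ∑ a ∈ T, x a.rev * x a = 0 := by
  rw [← neg_eq_zero, ← Finset.sum_neg_distrib, ← h.sum_mul_rev hT]
  exact Finset.sum_congr rfl fun a _ => (h.anti a a.rev).symm

theorem linForm_mul_var (T : Finset (Fin (2 * n))) (c i : Fin (2 * n)) (r : ℤ) (hr : r < 0) :
    linForm x φ T c r hr * x i = -(x i * linForm x φ T c r hr) := by
  rw [linForm, Finset.sum_mul, Finset.mul_sum, ← Finset.sum_neg_distrib]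
  refine Finset.sum_congr rfl fun b _ => ?_
  rw [mul_assoc, ← (h.comm i _).eq, ← mul_assoc, h.anti b i, neg_mul, mul_assoc]

theorem commute_var_quadForm (T : Finset (Fin (2 * n))) (i : Fin (2 * n)) (r : ℤ) (hr : r < 0) :
    Commute (x i) (quadForm x φ T r hr) := by
  refine Commute.smul_right (Commute.sum_right _ _ _ fun a _ => ?_) _
  rw [commute_iff_eq, mul_assoc, h.linForm_mul_var, mul_neg, ← mul_assoc, ← mul_assoc, h.anti i a,
    neg_mul]

theorem sum_ite_contract_left {T : Finset (Fin (2 * n))} (hT : ∀ a ∈ T, a.rev ∈ T)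
    (G : Fin (2 * n) → W) :
    ∑ b ∈ T, ∑ i ∈ T, ∑ j ∈ T, x b * x i * x j * ((if b.rev = i then (1 : ℂ) else 0) • G j) = 0 := by
  have e : ∀ b ∈ T, ∑ i ∈ T, ∑ j ∈ T,
      x b * x i * x j * ((if b.rev = i then (1 : ℂ) else 0) • G j) =
      x b * x b.rev * ∑ j ∈ T, x j * G j := by
    intro b hb
    rw [Finset.sum_eq_single_of_mem b.rev (hT b hb), Finset.mul_sum]
    · simp [mul_assoc]
    · intro i _ hi; simp [hi.symm]
  rw [Finset.sum_congr rfl e, ← Finset.sum_mul, h.sum_mul_rev hT, zero_mul]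

theorem sum_ite_contract_right {T : Finset (Fin (2 * n))} (hT : ∀ a ∈ T, a.rev ∈ T)
    (G : Fin (2 * n) → W) :
    ∑ b ∈ T, ∑ i ∈ T, ∑ j ∈ T, x b * x i * x j * ((if b = j.rev then (1 : ℂ) else 0) • G i) = 0 := by
  rw [Finset.sum_comm]
  refine Finset.sum_eq_zero fun i _ => ?_
  have e : ∀ b ∈ T, ∑ j ∈ T, x b * x i * x j * ((if b = j.rev then (1 : ℂ) else 0) • G i) =
      -(x i * (x b * x b.rev) * G i) := by
    intro b hb
    rw [Finset.sum_eq_single_of_mem b.rev (hT b hb)]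
    · simp [h.anti b i, mul_assoc]
    · intro j _ hj
      rw [if_neg fun hbj => hj (by rw [hbj, Fin.rev_rev])]
      simp
  rw [Finset.sum_congr rfl e, Finset.sum_neg_distrib, ← Finset.sum_mul, ← Finset.mul_sum,
    h.sum_mul_rev hT, mul_zero, zero_mul, neg_zero]

theorem sum_ite_right {T : Finset (Fin (2 * n))} (hT : ∀ a ∈ T, a.rev ∈ T) (c : Fin (2 * n))
    (G : Fin (2 * n) → Fin (2 * n) → W) :
    ∑ b ∈ T, ∑ i ∈ T, ∑ j ∈ T, x b * x i * x j * ((if c = j.rev then (1 : ℂ) else 0) • G i b) =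
      if c ∈ T then -(x c.rev * ∑ i ∈ T, ∑ b ∈ T, x i * x b * G i b) else 0 := by
  split_ifs with hc
  · rw [Finset.sum_comm, Finset.mul_sum, ← Finset.sum_neg_distrib]
    refine Finset.sum_congr rfl fun i _ => ?_
    rw [Finset.mul_sum, ← Finset.sum_neg_distrib]
    refine Finset.sum_congr rfl fun b _ => ?_
    rw [Finset.sum_eq_single_of_mem c.rev (hT c hc)]
    · rw [← (h.commute_pair c.rev b i).eq, h.anti b i]
      simp [mul_assoc]
    · intro j _ hj
      rw [if_neg fun hbj => hj (by rw [hbj, Fin.rev_rev])]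
      simp
  · refine Finset.sum_eq_zero fun b _ => Finset.sum_eq_zero fun i _ => Finset.sum_eq_zero
      fun j hj => ?_
    rw [if_neg fun hcj : c = j.rev => hc (hcj ▸ hT j hj)]
    simp

theorem sum_ite_left {T : Finset (Fin (2 * n))} (hT : ∀ a ∈ T, a.rev ∈ T) (c : Fin (2 * n))
    (G : Fin (2 * n) → Fin (2 * n) → W) :
    ∑ b ∈ T, ∑ i ∈ T, ∑ j ∈ T, x b * x i * x j * ((if c.rev = i then (1 : ℂ) else 0) • G b j) =
      if c ∈ T then -(x c.rev * ∑ b ∈ T, ∑ j ∈ T, x b * x j * G b j) else 0 := by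
  split_ifs with hc
  · rw [Finset.mul_sum, ← Finset.sum_neg_distrib]
    refine Finset.sum_congr rfl fun b _ => ?_
    rw [Finset.sum_eq_single_of_mem c.rev (hT c hc), Finset.mul_sum, ← Finset.sum_neg_distrib]
    · refine Finset.sum_congr rfl fun j _ => ?_
      simp [h.anti b c.rev, mul_assoc]
    · intro i _ hi; simp [hi.symm]
  · refine Finset.sum_eq_zero fun b _ => Finset.sum_eq_zero fun i hi => Finset.sum_eq_zero
      fun j _ => ?_
    rw [if_neg fun hci : c.rev = i => hc (by have := hT i hi; rwa [← hci, Fin.rev_rev] at this)]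
    simp

/-- Of the four terms of `lie_F_F`, the two that contract summation indices with each other contain
`∑ x_a x_{-a} = 0`. The two that contract with `c` are equal and occur only if `c ∈ T`. -/
theorem commutator_linForm_quadForm {T : Finset (Fin (2 * n))} (hT : ∀ a ∈ T, a.rev ∈ T)
    (c : Fin (2 * n)) (r s : ℤ) (hr : r < 0) (hs : s < 0) :
    linForm x φ T c r hr * quadForm x φ T s hs - quadForm x φ T s hs * linForm x φ T c r hr =
      if c ∈ T then (2 : ℂ) • (x c.rev * quadForm x φ T (r + s) (by omega)) else 0 := by
  have key : ∀ b i j : Fin (2 * n),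
      (x b * φ (uElt (F c b.rev) r hr)) * (x i * (x j * φ (uElt (F i j.rev) s hs))) -
        (x i * (x j * φ (uElt (F i j.rev) s hs))) * (x b * φ (uElt (F c b.rev) r hr)) =
      x b * x i * x j * φ (uElt ⁅F c b.rev, F i j.rev⁆ (r + s) (by omega)) := by
    intro b i j
    have hi := h.comm i (uElt (F c b.rev) r hr)
    have hj := h.comm j (uElt (F c b.rev) r hr)
    have hb := h.comm b (uElt (F i j.rev) s hs)
    rw [← map_uElt_lie (F c b.rev) (F i j.rev) r s hr hs]
    generalize φ (uElt (F c b.rev) r hr) = f at *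
    generalize φ (uElt (F i j.rev) s hs) = g at *
    rw [mul_sub, mul_mul_of_commute hi hj, mul_mul_of_commute' hb (h.commute_pair b i j)]
  have hexp : linForm x φ T c r hr * quadForm x φ T s hs -
        quadForm x φ T s hs * linForm x φ T c r hr =
      (2⁻¹ : ℂ) • ∑ b ∈ T, ∑ i ∈ T, ∑ j ∈ T,
        x b * x i * x j * φ (uElt ⁅F c b.rev, F i j.rev⁆ (r + s) (by omega)) := by
    simp only [← key, Finset.sum_sub_distrib]
    rw [quadForm, mul_smul_comm, smul_mul_assoc, ← smul_sub]
    congr 2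
    · simp only [linForm, Finset.sum_mul]
      refine Finset.sum_congr rfl fun b _ => ?_
      simp only [Finset.mul_sum]
    · simp only [linForm, Finset.mul_sum]
      refine Finset.sum_congr rfl fun b _ => ?_
      simp only [Finset.sum_mul]
  have hquad : ∑ a ∈ T, ∑ b ∈ T, x a * x b * φ (uElt (F a b.rev) (r + s) (by omega)) =
      (2 : ℂ) • quadForm x φ T (r + s) (by omega) := by
    rw [quadForm, smul_smul, mul_inv_cancel₀ (two_ne_zero' ℂ), one_smul]
    simp only [linForm, Finset.mul_sum, mul_assoc]
  rw [hexp]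
  simp only [map_bracket_F, Fin.rev_rev, mul_add, mul_sub, Finset.sum_add_distrib,
    Finset.sum_sub_distrib]
  rw [h.sum_ite_contract_left hT (fun j => φ (uElt (F c j.rev) (r + s) (by omega))),
    h.sum_ite_right hT c (fun i b => φ (uElt (F i b.rev) (r + s) (by omega))),
    h.sum_ite_left hT c (fun b j => φ (uElt (F b j.rev) (r + s) (by omega))),
    h.sum_ite_contract_right hT (fun i => φ (uElt (F i c.rev) (r + s) (by omega))), hquad]
  split_ifs
  · rw [mul_smul_comm]; module
  · simp

/-- Summing `x_a` times the commutators of the linear forms again produces the factor `∑ x_a x_{-a}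
= 0`. -/
theorem commute_quadForm {T : Finset (Fin (2 * n))} (hT : ∀ a ∈ T, a.rev ∈ T)
    (r s : ℤ) (hr : r < 0) (hs : s < 0) :
    Commute (quadForm x φ T r hr) (quadForm x φ T s hs) := by
  have hsum := h.sum_mul_rev hT
  rw [commute_iff_eq, ← sub_eq_zero]
  have e : quadForm x φ T r hr * quadForm x φ T s hs - quadForm x φ T s hs * quadForm x φ T r hr =
      (2⁻¹ : ℂ) • ∑ a ∈ T, x a * (linForm x φ T a r hr * quadForm x φ T s hs -
        quadForm x φ T s hs * linForm x φ T a r hr) := by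
    conv_lhs => rw [quadForm.eq_1 x φ T r hr]
    rw [smul_mul_assoc, mul_smul_comm, ← smul_sub, Finset.sum_mul, Finset.mul_sum,
      ← Finset.sum_sub_distrib]
    congr 1
    refine Finset.sum_congr rfl fun a _ => ?_
    rw [mul_sub, ← mul_assoc (quadForm x φ T s hs), ← (h.commute_var_quadForm T a s hs).eq,
      mul_assoc, mul_assoc]
  rw [e]
  have e2 : ∀ a ∈ T, x a * (linForm x φ T a r hr * quadForm x φ T s hs -
        quadForm x φ T s hs * linForm x φ T a r hr) =
      (2 : ℂ) • ((x a * x a.rev) * quadForm x φ T (r + s) (by omega)) := by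
    intro a ha
    rw [h.commutator_linForm_quadForm hT, if_pos ha, mul_smul_comm, mul_assoc]
  rw [Finset.sum_congr rfl e2, ← Finset.smul_sum, ← Finset.sum_mul, hsum]
  simp

theorem commute_linForm_quadForm {T : Finset (Fin (2 * n))} (hT : ∀ a ∈ T, a.rev ∈ T)
    {c : Fin (2 * n)} (hc : c ∉ T) (r s : ℤ) (hr : r < 0) (hs : s < 0) :
    Commute (linForm x φ T c r hr) (quadForm x φ T s hs) := by
  rw [commute_iff_eq, ← sub_eq_zero, h.commutator_linForm_quadForm hT, if_neg hc]

/-- Since `p` and `p.rev` lie outside `T`, the bracket of `F_{p,-a}` and `F_{-p,-b}` is `-F_{a,-b}`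
plus a diagonal term that sums to zero. The resulting quadratic form of degree `r + s` is the source
of `ad_τ`. -/
theorem anticommutator_linForm {T : Finset (Fin (2 * n))} (hT : ∀ a ∈ T, a.rev ∈ T)
    {p : Fin (2 * n)} (hp : p ∉ T) (r s : ℤ) (hr : r < 0) (hs : s < 0) :
    linForm x φ T p r hr * linForm x φ T p.rev s hs +
      linForm x φ T p.rev s hs * linForm x φ T p r hr =
      -((2 : ℂ) • quadForm x φ T (r + s) (by omega)) := by
  have key : ∀ a b : Fin (2 * n),
      (x a * φ (uElt (F p a.rev) r hr)) * (x b * φ (uElt (F p.rev b.rev) s hs)) +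
        (x b * φ (uElt (F p.rev b.rev) s hs)) * (x a * φ (uElt (F p a.rev) r hr)) =
      x a * x b * φ (uElt ⁅F p a.rev, F p.rev b.rev⁆ (r + s) (by omega)) := by
    intro a b
    have hb := h.comm b (uElt (F p a.rev) r hr)
    have ha := h.comm a (uElt (F p.rev b.rev) s hs)
    rw [← map_uElt_lie (F p a.rev) (F p.rev b.rev) r s hr hs]
    generalize φ (uElt (F p a.rev) r hr) = f at *
    generalize φ (uElt (F p.rev b.rev) s hs) = g at *
    rw [mul_sub, mul_mul_of_commute₂ hb, mul_mul_of_commute₂ ha, h.anti b a, neg_mul,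
      sub_eq_add_neg]
  have hp' : p.rev ∉ T := fun h' => hp (by simpa using hT _ h')
  have e : ∀ a ∈ T, ∀ b ∈ T,
      φ (uElt ⁅F p a.rev, F p.rev b.rev⁆ (r + s) (by omega)) =
        -φ (uElt (F a b.rev) (r + s) (by omega)) +
        (if a = b.rev then (1 : ℂ) else 0) • φ (uElt (F p.rev p.rev) (r + s) (by omega)) := by
    intro a ha b hb
    have h1 : a.rev ≠ p.rev := fun h' => hp (by rwa [← Fin.rev_injective h'])
    have h2 : p ≠ b.rev := fun h' => hp (h' ▸ hT b hb)
    rw [map_bracket_F, if_neg h1, if_neg h2, if_pos rfl, Fin.rev_rev]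
    simp
  rw [linForm, linForm, Finset.sum_mul_sum, Finset.sum_mul_sum]
  rw [Finset.sum_comm (s := T) (t := T) (f := fun b a => (x b * φ (uElt (F p.rev b.rev) s hs)) *
    (x a * φ (uElt (F p a.rev) r hr)))]
  simp only [← Finset.sum_add_distrib, key]
  rw [Finset.sum_congr rfl fun a ha => Finset.sum_congr rfl fun b hb => by rw [e a ha b hb]]
  simp only [mul_add, Finset.sum_add_distrib]
  have z : ∑ a ∈ T, ∑ b ∈ T, x a * x b * ((if a = b.rev then (1 : ℂ) else 0) •
      φ (uElt (F p.rev p.rev) (r + s) (by omega))) = 0 := by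
    rw [Finset.sum_comm]
    have : ∀ b ∈ T, ∑ a ∈ T, x a * x b * ((if a = b.rev then (1 : ℂ) else 0) •
        φ (uElt (F p.rev p.rev) (r + s) (by omega))) =
        x b.rev * x b * φ (uElt (F p.rev p.rev) (r + s) (by omega)) := by
      intro b hb
      rw [Finset.sum_eq_single_of_mem b.rev (hT b hb)]
      · simp
      · intro a _ ha; simp [ha]
    rw [Finset.sum_congr rfl this, ← Finset.sum_mul, h.sum_rev_mul hT, zero_mul]
  rw [z, add_zero, quadForm, smul_smul, mul_inv_cancel₀ (two_ne_zero' ℂ), one_smul,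
    ← Finset.sum_neg_distrib]
  refine Finset.sum_congr rfl fun a _ => ?_
  rw [linForm, Finset.mul_sum, ← Finset.sum_neg_distrib]
  refine Finset.sum_congr rfl fun b _ => ?_
  rw [mul_neg, mul_assoc]

end IsGrassmann

end Grassmann

/-! ### Splitting off a pair of Grassmann variables -/

section Splitting

/-- The binomial expansion stops after `e²`, with `(k + 1) k / 2` as its coefficient. For `k = 0`
the truncated exponent `k - 1` is harmless, because this coefficient vanishes. -/
theorem add_pow_of_cube_eq_zero {W : Type*} [Ring W] [Algebra ℂ W] {a e : W} (h : Commute a e)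
    (he : e * e * e = 0) (k : ℕ) :
    (a + e) ^ (k + 1) = a ^ (k + 1) + ((k + 1 : ℕ) : ℂ) • (a ^ k * e) +
      (((k + 1) * k : ℕ) : ℂ) • (2⁻¹ : ℂ) • (a ^ (k - 1) * (e * e)) := by
  have h1 : e * a = a * e := h.eq.symm
  induction k with
  | zero => simp
  | succ k ih =>
    have h2 : e * e * a = a * (e * e) := by rw [mul_assoc, h1, ← mul_assoc, h1, mul_assoc]
    have h3 : (((k + 1) * k : ℕ) : ℂ) • (2⁻¹ : ℂ) • (a ^ (k - 1) * (e * e) * (a + e)) =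
        (((k + 1) * k : ℕ) : ℂ) • (2⁻¹ : ℂ) • (a ^ k * (e * e)) := by
      rcases k with _ | k
      · simp
      · rw [mul_assoc, mul_add (e * e), h2, he, add_zero, ← mul_assoc, add_tsub_cancel_right,
          ← pow_succ]
    rw [pow_succ, ih, add_mul, add_mul, smul_mul_assoc, smul_mul_assoc, smul_mul_assoc, h3,
      Nat.add_sub_cancel]
    have h4 : a ^ k * e * (a + e) = a ^ (k + 1) * e + a ^ k * (e * e) := by
      rw [mul_add, mul_assoc, h1, ← mul_assoc, ← pow_succ, mul_assoc]
    rw [h4, mul_add, ← pow_succ]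
    push_cast
    module

/-- Each of `u`, `v` can occur at most once in a nonzero product. So only the two mixed products
survive in the square, in opposite orders of `A` and `B`, and nothing survives in the cube. -/
theorem grassmann_sq {W : Type*} [Ring W] {u v A B g : W} (hu : u * u = 0) (hv : v * v = 0)
    (hvu : v * u = -(u * v)) (hAu : A * u = -(u * A)) (hAv : A * v = -(v * A))
    (hBu : B * u = -(u * B)) (hBv : B * v = -(v * B)) (hgu : g * u = u * g) (hgv : g * v = v * g) :
    (u * A + v * B + u * v * g) * (u * A + v * B + u * v * g) = u * v * (B * A - A * B) ∧
    (u * A + v * B + u * v * g) * (u * A + v * B + u * v * g) *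
      (u * A + v * B + u * v * g) = 0 := by
  have h1 : ∀ w, u * (u * w) = 0 := fun w => by rw [← mul_assoc, hu, zero_mul]
  have h2 : ∀ w, v * (v * w) = 0 := fun w => by rw [← mul_assoc, hv, zero_mul]
  have h3 : ∀ w, v * (u * w) = -(u * (v * w)) := fun w => by
    rw [← mul_assoc, hvu, neg_mul, mul_assoc]
  have h4 : ∀ w, A * (u * w) = -(u * (A * w)) := fun w => by
    rw [← mul_assoc, hAu, neg_mul, mul_assoc]
  have h5 : ∀ w, A * (v * w) = -(v * (A * w)) := fun w => by
    rw [← mul_assoc, hAv, neg_mul, mul_assoc]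
  have h6 : ∀ w, B * (u * w) = -(u * (B * w)) := fun w => by
    rw [← mul_assoc, hBu, neg_mul, mul_assoc]
  have h7 : ∀ w, B * (v * w) = -(v * (B * w)) := fun w => by
    rw [← mul_assoc, hBv, neg_mul, mul_assoc]
  have h8 : ∀ w, g * (u * w) = u * (g * w) := fun w => by rw [← mul_assoc, hgu, mul_assoc]
  have h9 : ∀ w, g * (v * w) = v * (g * w) := fun w => by rw [← mul_assoc, hgv, mul_assoc]
  constructor
  · simp only [mul_add, add_mul, mul_sub, mul_assoc, h1, h2, h3, h4, h5, h6, h7, h8, h9, mul_neg,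
      neg_neg, mul_zero, neg_zero, add_zero, zero_add]
    abel
  · simp only [mul_add, add_mul, mul_assoc, h1, h2, h3, h4, h5, h6, h7, h8, h9, mul_neg,
      neg_mul, zero_mul, neg_neg, mul_zero, neg_zero, add_zero]

variable {n : ℕ} {W : Type*} [Ring W] [Algebra ℂ W] {x : Fin (2 * n) → W}
  {φ : UNeg (orth n) →ₐ[ℂ] W}

theorem rev_ne_self (p : Fin (2 * n)) : p ≠ p.rev := by
  intro h
  have := congrArg Fin.val h
  rw [Fin.val_rev] at this
  omega

theorem map_uElt_F_rev (i j : Fin (2 * n)) (r : ℤ) (hr : r < 0) :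
    φ (uElt (F j.rev i.rev) r hr) = -φ (uElt (F i j) r hr) := by
  rw [F_rev, uElt_neg, map_neg]

theorem map_uElt_F_rev_right (i j : Fin (2 * n)) (r : ℤ) (hr : r < 0) :
    φ (uElt (F i j.rev) r hr) = -φ (uElt (F j i.rev) r hr) := by
  rw [← map_uElt_F_rev, Fin.rev_rev]

theorem map_uElt_F_rev_left (i j : Fin (2 * n)) (r : ℤ) (hr : r < 0) :
    φ (uElt (F i j) r hr) = -φ (uElt (F j.rev i.rev) r hr) := by
  rw [map_uElt_F_rev, neg_neg]

namespace IsGrassmann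

variable (h : IsGrassmann x φ)
include h

/-- Every cross term occurs twice, since both `x_a x_b` and `F_{a,-b}` are antisymmetric; this
absorbs the ½. -/
theorem quadForm_insert {T : Finset (Fin (2 * n))} {p : Fin (2 * n)} (hp : p ∉ T)
    (hp' : p.rev ∉ T) (r : ℤ) (hr : r < 0) :
    quadForm x φ (insert p (insert p.rev T)) r hr = quadForm x φ T r hr +
      (x p * linForm x φ T p r hr + x p.rev * linForm x φ T p.rev r hr +
        x p * x p.rev * φ (uElt (F p p) r hr)) := by
  have hp2 : p ∉ insert p.rev T := by
    rw [Finset.mem_insert, not_or]; exact ⟨rev_ne_self p, hp⟩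
  have hlin : ∀ c, linForm x φ (insert p (insert p.rev T)) c r hr =
      x p * φ (uElt (F c p.rev) r hr) + (x p.rev * φ (uElt (F c p) r hr) +
        linForm x φ T c r hr) := by
    intro c
    rw [linForm, Finset.sum_insert hp2, Finset.sum_insert hp', Fin.rev_rev, linForm]
  have e1 : ∑ a ∈ T, x a * (x p * φ (uElt (F a p.rev) r hr)) = x p * linForm x φ T p r hr := by
    rw [linForm, Finset.mul_sum]
    refine Finset.sum_congr rfl fun a _ => ?_
    rw [map_uElt_F_rev_right a p r hr]
    generalize φ (uElt (F p a.rev) r hr) = f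
    rw [← mul_assoc, h.anti a p, mul_neg, neg_mul, neg_neg, mul_assoc]
  have e2 : ∑ a ∈ T, x a * (x p.rev * φ (uElt (F a p) r hr)) =
      x p.rev * linForm x φ T p.rev r hr := by
    rw [linForm, Finset.mul_sum]
    refine Finset.sum_congr rfl fun a _ => ?_
    rw [map_uElt_F_rev_left a p r hr]
    generalize φ (uElt (F p.rev a.rev) r hr) = f
    rw [← mul_assoc, h.anti a p.rev, mul_neg, neg_mul, neg_neg, mul_assoc]
  have e3 : ∀ (i : Fin (2 * n)) (f : W), x i * (x i * f) = 0 := by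
    intro i f; rw [← mul_assoc, h.sq, zero_mul]
  have e4 : x p.rev * (x p * φ (uElt (F p.rev p.rev) r hr)) =
      x p * (x p.rev * φ (uElt (F p p) r hr)) := by
    rw [map_uElt_F_rev]
    generalize φ (uElt (F p p) r hr) = f
    rw [← mul_assoc, h.anti p.rev p, mul_neg, neg_mul, neg_neg, mul_assoc]
  rw [quadForm, Finset.sum_insert hp2, Finset.sum_insert hp', quadForm]
  simp only [hlin, mul_add, Finset.sum_add_distrib]
  rw [e1, e2, e3, e3, e4, mul_assoc]
  module

theorem commute_diag_quadForm {T : Finset (Fin (2 * n))} (hT : ∀ a ∈ T, a.rev ∈ T)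
    {p : Fin (2 * n)} (hp : p ∉ T) (r s : ℤ) (hr : r < 0) (hs : s < 0) :
    Commute (φ (uElt (F p p) r hr)) (quadForm x φ T s hs) := by
  refine Commute.smul_right (Commute.sum_right _ _ _ fun a ha => Commute.mul_right
    (h.comm a _).symm (Commute.sum_right _ _ _ fun b hb => Commute.mul_right
    (h.comm b _).symm ?_)) _
  have h1 : p ≠ a := fun h' => hp (h' ▸ ha)
  have h2 : p ≠ b.rev := fun h' => hp (h' ▸ hT b hb)
  have h3 : p.rev ≠ a := fun h' => hp (by have := hT a ha; rwa [← h', Fin.rev_rev] at this)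
  have h4 : p.rev ≠ b.rev := fun h' => hp (by rwa [Fin.rev_injective h'])
  have e := map_uElt_lie (φ := φ) (F p p) (F a b.rev) r s hr hs
  rw [map_bracket_F, if_neg h1, if_neg h2, if_neg h3, if_neg h4] at e
  rw [commute_iff_eq, ← sub_eq_zero, e]
  simp

/-- In the square of the increment the linear form of `p` is ordered to the right, ready to fall
into the left ideal; the reordering costs the quadratic form of degree `r + r`. The variable `s`
allows this degree to be written `-2` in the application. -/
theorem quadForm_insert_pow {T : Finset (Fin (2 * n))} (hT : ∀ a ∈ T, a.rev ∈ T)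
    {p : Fin (2 * n)} (hp : p ∉ T) (r s : ℤ) (hr : r < 0) (hs : s < 0) (hrs : r + r = s) (k : ℕ) :
    quadForm x φ (insert p (insert p.rev T)) r hr ^ (k + 1) =
      quadForm x φ T r hr ^ (k + 1) +
      ((k + 1 : ℕ) : ℂ) • (quadForm x φ T r hr ^ k * (x p * linForm x φ T p r hr +
        x p.rev * linForm x φ T p.rev r hr + x p * x p.rev * φ (uElt (F p p) r hr))) +
      (((k + 1) * k : ℕ) : ℂ) • (quadForm x φ T r hr ^ (k - 1) *
        (x p.rev * linForm x φ T p.rev r hr * (x p * linForm x φ T p r hr) +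
          x p * x p.rev * quadForm x φ T s hs)) := by
  subst hrs
  have hp' : p.rev ∉ T := fun h' => hp (by simpa using hT _ h')
  have hcomm : Commute (quadForm x φ T r hr) (x p * linForm x φ T p r hr +
        x p.rev * linForm x φ T p.rev r hr + x p * x p.rev * φ (uElt (F p p) r hr)) := by
    refine Commute.add_right (Commute.add_right ?_ ?_) ?_
    · exact (h.commute_var_quadForm T p r hr).symm.mul_right
        (h.commute_linForm_quadForm hT hp r r hr hr).symm
    · exact (h.commute_var_quadForm T p.rev r hr).symm.mul_right
        (h.commute_linForm_quadForm hT hp' r r hr hr).symm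
    · exact Commute.mul_right ((h.commute_var_quadForm T p r hr).symm.mul_right
        (h.commute_var_quadForm T p.rev r hr).symm) (h.commute_diag_quadForm hT hp r r hr hr).symm
  have hanti := h.anticommutator_linForm hT hp r r hr hr
  have hgu := (h.comm p (uElt (F p p) r hr)).symm.eq
  have hgv := (h.comm p.rev (uElt (F p p) r hr)).symm.eq
  rw [h.quadForm_insert hp hp']
  generalize φ (uElt (F p p) r hr) = g at *
  have hAu := h.linForm_mul_var T p p r hr
  have hAv := h.linForm_mul_var T p p.rev r hr
  have hBu := h.linForm_mul_var T p.rev p r hr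
  have hBv := h.linForm_mul_var T p.rev p.rev r hr
  generalize linForm x φ T p r hr = A at *
  generalize linForm x φ T p.rev r hr = B at *
  generalize quadForm x φ T (r + r) hs = Q at *
  obtain ⟨hsq, hcube⟩ := grassmann_sq (h.sq p) (h.sq p.rev) (h.anti p.rev p) hAu hAv hBu hBv hgu hgv
  rw [add_pow_of_cube_eq_zero hcomm hcube, hsq]
  congr 2
  rw [← mul_smul_comm]
  congr 1
  have hAB : A * B = -((2 : ℂ) • Q) - B * A := eq_sub_of_add_eq hanti
  have hBA : x p.rev * B * (x p * A) = x p * x p.rev * (B * A) := by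
    rw [mul_assoc, ← mul_assoc B, hBu, neg_mul, mul_neg, mul_assoc, ← mul_assoc (x p.rev),
      h.anti p.rev p, neg_mul, neg_neg, mul_assoc]
  rw [hBA, ← mul_add, ← mul_smul_comm]
  congr 1
  rw [hAB]
  module

end IsGrassmann

end Splitting

/-! ### The recurrence for the Pfaffians -/

section Recurrence

variable {n : ℕ} {W : Type*} [Ring W] [Algebra ℂ W] {x : Fin (2 * n) → W}
  {φ : UNeg (orth n) →ₐ[ℂ] W}

/-- Properties of the top coefficient map on the algebra generated by `U(t⁻¹ o_{2n}[t⁻¹])` and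
Grassmann variables. -/
structure IsTopCoeff (x : Fin (2 * n) → W) (φ : UNeg (orth n) →ₐ[ℂ] W)
    (E : W →ₗ[ℂ] UNeg (orth n)) (K : Fin (2 * n) → W →ₐ[ℂ] W) (D : W →ₗ[ℂ] W) : Prop
    extends IsGrassmann x φ where
  left : ∀ u w, E (φ u * w) = u * E w
  right : ∀ u w, E (w * φ u) = E w * u
  kill_base : ∀ p u, K p (φ u) = φ u
  kill_var : ∀ p i, i ≠ p → K p (x i) = x i
  kill : ∀ p w, E (K p w) = 0
  der_mul : ∀ v w, D (v * w) = v * D w + D v * w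
  der_var : ∀ i, D (x i) = 0
  der_base : ∀ u, D (φ u) = φ (adTau (orth n) u)
  der : ∀ w, E (D w) = adTau (orth n) (E w)

/-- `Θ` is a polynomial in the Grassmann variables outside `T`. -/
structure IsSpectator (φ : UNeg (orth n) →ₐ[ℂ] W) (K : Fin (2 * n) → W →ₐ[ℂ] W) (D : W →ₗ[ℂ] W)
    (T : Finset (Fin (2 * n))) (Θ : W) : Prop where
  comm : ∀ u, Commute Θ (φ u)
  kill : ∀ p ∈ T, K p Θ = Θ
  der : D Θ = 0

theorem mul_mul_eq_of_commute {R : Type*} [Monoid R] {Θ P y g : R} (h1 : Commute P y)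
    (h2 : Commute g P) (h3 : Commute (Θ * y) g) : Θ * (P * (y * g)) = g * (Θ * y * P) := by
  rw [← mul_assoc P, h1.eq, mul_assoc y, ← h2.eq, ← mul_assoc g, ← h3.eq]
  simp only [mul_assoc]

theorem mul_mul_eq_of_commute' {R : Type*} [Monoid R] {Θ P y Q : R} (h : Commute P y) :
    Θ * (P * (y * Q)) = Θ * y * (P * Q) := by
  rw [← mul_assoc P, h.eq]
  simp only [mul_assoc]

theorem map_expansion {R V : Type*} [Ring R] [Algebra ℂ R] [AddCommGroup V] [Module ℂ V]
    (E : R →ₗ[ℂ] V) (Θ P P' a b m a' b' : R) (P'' : R) {c c' : ℂ} :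
    E (Θ * (P + c • (P' * (a + b + m)) + c' • (P'' * (a' + b')))) =
      E (Θ * P) + c • (E (Θ * (P' * a)) + E (Θ * (P' * b)) + E (Θ * (P' * m))) +
        c' • (E (Θ * (P'' * a')) + E (Θ * (P'' * b'))) := by
  simp only [mul_add, mul_smul_comm, map_add, map_smul]

variable {E : W →ₗ[ℂ] UNeg (orth n)} {K : Fin (2 * n) → W →ₐ[ℂ] W} {D : W →ₗ[ℂ] W}

namespace IsTopCoeff

variable (h : IsTopCoeff x φ E K D)
include h

theorem kill_linForm {p : Fin (2 * n)} {T : Finset (Fin (2 * n))} (hp : p ∉ T) (c : Fin (2 * n))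
    (r : ℤ) (hr : r < 0) : K p (linForm x φ T c r hr) = linForm x φ T c r hr := by
  rw [linForm, map_sum]
  refine Finset.sum_congr rfl fun b hb => ?_
  rw [map_mul, h.kill_base, h.kill_var p b (fun hbp => hp (hbp ▸ hb))]

theorem kill_quadForm {p : Fin (2 * n)} {T : Finset (Fin (2 * n))} (hp : p ∉ T)
    (r : ℤ) (hr : r < 0) : K p (quadForm x φ T r hr) = quadForm x φ T r hr := by
  rw [quadForm, map_smul, map_sum]
  congr 1
  refine Finset.sum_congr rfl fun b hb => ?_
  rw [map_mul, h.kill_linForm hp, h.kill_var p b (fun hbp => hp (hbp ▸ hb))]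

theorem der_linForm (T : Finset (Fin (2 * n))) (c : Fin (2 * n)) :
    D (linForm x φ T c (-1) (by norm_num)) = linForm x φ T c (-2) (by norm_num) := by
  rw [linForm, map_sum]
  refine Finset.sum_congr rfl fun b _ => ?_
  have e : adTau (orth n) (uElt (F c b.rev) (-1) (by norm_num)) =
      uElt (F c b.rev) (-2) (by norm_num) := by
    rw [adTau_uElt, Int.cast_neg, Int.cast_one, neg_neg, one_smul]
    rfl
  rw [h.der_mul, h.der_var, h.der_base, zero_mul, add_zero, e]

theorem der_quadForm (T : Finset (Fin (2 * n))) :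
    D (quadForm x φ T (-1) (by norm_num)) = quadForm x φ T (-2) (by norm_num) := by
  rw [quadForm, map_smul, map_sum]
  congr 1
  refine Finset.sum_congr rfl fun b _ => ?_
  rw [h.der_mul, h.der_var, h.der_linForm, zero_mul, add_zero]

/-- The usual power rule is valid because the quadratic form commutes with its derivative. -/
theorem der_quadForm_pow {T : Finset (Fin (2 * n))} (hT : ∀ a ∈ T, a.rev ∈ T) (k : ℕ) :
    D (quadForm x φ T (-1) (by norm_num) ^ k) = (k : ℂ) • (quadForm x φ T (-1) (by norm_num) ^ (k - 1) *
      quadForm x φ T (-2) (by norm_num)) := by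
  have hc := h.commute_quadForm hT (-2) (-1) (by norm_num) (by norm_num)
  have hD := h.der_quadForm T
  generalize quadForm x φ T (-1) (by norm_num) = O at *
  generalize quadForm x φ T (-2) (by norm_num) = Q at *
  have h1 : D 1 = 0 := by
    have := h.der_mul 1 1
    rw [one_mul, mul_one, one_mul] at this
    exact left_eq_add.1 this
  induction k with
  | zero => simp [h1]
  | succ k ih =>
    rw [pow_succ, h.der_mul, ih, hD, smul_mul_assoc, mul_assoc, hc.eq, ← mul_assoc,
      add_tsub_cancel_right]
    rcases k with _ | k
    · simp
    · rw [add_tsub_cancel_right, ← pow_succ]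
      push_cast
      module

/-- The spectator collects the pairs already split off, while `T` shrinks. -/
theorem spectator_pair {T : Finset (Fin (2 * n))} {p : Fin (2 * n)} (hp : p ∉ T)
    (hp' : p.rev ∉ T) {Θ : W} (hΘ : IsSpectator φ K D (insert p (insert p.rev T)) Θ) :
    IsSpectator φ K D T (Θ * (x p * x p.rev)) where
  comm u := (hΘ.comm u).mul_left ((h.comm p u).mul_left (h.comm p.rev u))
  kill q hq := by
    rw [map_mul, map_mul, hΘ.kill q (by simp [hq]), h.kill_var q p fun hpq => hp (hpq ▸ hq),
      h.kill_var q p.rev fun hpq => hp' (hpq ▸ hq)]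
  der := by
    rw [h.der_mul, h.der_mul, h.der_var, h.der_var, hΘ.der]
    simp

/-- A polynomial unchanged by `x_p ↦ 0` has no term containing every variable. -/
theorem eval_fixed {w : W} (p : Fin (2 * n)) (hw : K p w = w) : E w = 0 := by
  rw [← hw, h.kill]

theorem eval_mul_linForm_mem {T : Finset (Fin (2 * n))} {p : Fin (2 * n)}
    (hlt : ∀ c ∈ T, p < c.rev) (r : ℤ) (hr : r < 0) (w : W) :
    E (w * linForm x φ T p r hr) ∈ upperIdeal n := by
  rw [linForm, Finset.mul_sum, map_sum]
  refine Submodule.sum_mem _ fun c hc => ?_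
  rw [← mul_assoc, h.right]
  exact (upperIdeal n).mul_mem_left _ (uElt_mem_upperIdeal (hlt c hc) r hr)

set_option maxHeartbeats 1000000 in
-- Only terms containing both `x_p` and `x_{-p}` reach the top coefficient. The linear one gives
-- `F_pp[-1]`. In the quadratic one, the ordered product lies in the ideal and the rest has the
-- factor `k` of the power rule, so it is `ad_τ`.
theorem eval_quadForm_insert {T : Finset (Fin (2 * n))} (hT : ∀ a ∈ T, a.rev ∈ T)
    {p : Fin (2 * n)} (hp : p ∉ T) (hlt : ∀ c ∈ T, p < c.rev) {Θ : W}
    (hΘ : IsSpectator φ K D (insert p (insert p.rev T)) Θ) (k : ℕ) :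
    E (Θ * quadForm x φ (insert p (insert p.rev T)) (-1) (by norm_num) ^ (k + 1)) -
      ((k + 1 : ℕ) : ℂ) • (uElt (F p p) (-1) (by norm_num) *
        E (Θ * (x p * x p.rev) * quadForm x φ T (-1) (by norm_num) ^ k) +
        adTau (orth n) (E (Θ * (x p * x p.rev) * quadForm x φ T (-1) (by norm_num) ^ k))) ∈
      upperIdeal n := by
  have hp' : p.rev ∉ T := fun h' => hp (by simpa using hT _ h')
  have hne := rev_ne_self p
  have hΘ' := h.spectator_pair hp hp' hΘ
  have hKp : K p Θ = Θ := hΘ.kill p (by simp)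
  have hKp' : K p.rev Θ = Θ := hΘ.kill p.rev (by simp)
  have hO := h.kill_quadForm hp (-1) (by norm_num)
  have hO' := h.kill_quadForm hp' (-1) (by norm_num)
  have hA := h.kill_linForm hp' p (-1) (by norm_num)
  have hB := h.kill_linForm hp p.rev (-1) (by norm_num)
  have hOx : Commute (quadForm x φ T (-1) (by norm_num)) (x p * x p.rev) :=
    (h.commute_var_quadForm T p (-1) (by norm_num)).symm.mul_right
      (h.commute_var_quadForm T p.rev (-1) (by norm_num)).symm
  have hgO := (h.commute_diag_quadForm hT hp (-1) (-1) (by norm_num) (by norm_num)).pow_right k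
  have hder := h.der_quadForm_pow hT k
  have hAmem := h.eval_mul_linForm_mem hlt (-1) (by norm_num)
  rw [h.quadForm_insert_pow hT hp (-1) (-2) (by norm_num) (by norm_num) (by norm_num)]
  generalize uElt (F p p) (-1) (by norm_num) = f at *
  generalize quadForm x φ T (-1) (by norm_num) = O at *
  generalize quadForm x φ T (-2) (by norm_num) = Q at *
  generalize linForm x φ T p (-1) (by norm_num) = A at *
  generalize linForm x φ T p.rev (-1) (by norm_num) = B at *
  have e0 : E (Θ * O ^ (k + 1)) = 0 := h.eval_fixed p (by rw [map_mul, map_pow, hKp, hO])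
  have e1 : E (Θ * (O ^ k * (x p * A))) = 0 :=
    h.eval_fixed p.rev (by
      rw [map_mul, map_mul, map_mul, map_pow, hKp', hO', hA, h.kill_var _ _ hne])
  have e2 : E (Θ * (O ^ k * (x p.rev * B))) = 0 :=
    h.eval_fixed p (by
      rw [map_mul, map_mul, map_mul, map_pow, hKp, hO, hB, h.kill_var _ _ hne.symm])
  have e3 : E (Θ * (O ^ k * (x p * x p.rev * φ f))) =
      f * E (Θ * (x p * x p.rev) * O ^ k) := by
    rw [← h.left f (Θ * (x p * x p.rev) * O ^ k)]
    exact congrArg E (mul_mul_eq_of_commute (hOx.pow_left k) hgO (hΘ'.comm f))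
  have e4 : E (Θ * (O ^ (k - 1) * (x p.rev * B * (x p * A)))) ∈ upperIdeal n := by
    have e := hAmem (Θ * (O ^ (k - 1) * (x p.rev * B * x p)))
    simpa only [mul_assoc] using e
  have e5 : adTau (orth n) (E (Θ * (x p * x p.rev) * O ^ k)) =
      (k : ℂ) • E (Θ * (O ^ (k - 1) * (x p * x p.rev * Q))) := by
    rw [← h.der, h.der_mul, hΘ'.der, zero_mul, add_zero, hder, mul_smul_comm, map_smul]
    exact congrArg (fun w => (k : ℂ) • E w) (mul_mul_eq_of_commute' (hOx.pow_left (k - 1))).symm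
  rw [e5, ← e3]
  have e6 : E (Θ * (O ^ (k + 1) + ((k + 1 : ℕ) : ℂ) • (O ^ k * (x p * A + x p.rev * B +
      x p * x p.rev * φ f)) + (((k + 1) * k : ℕ) : ℂ) • (O ^ (k - 1) *
        (x p.rev * B * (x p * A) + x p * x p.rev * Q)))) =
      ((k + 1 : ℕ) : ℂ) • E (Θ * (O ^ k * (x p * x p.rev * φ f))) +
        (((k + 1) * k : ℕ) : ℂ) • (E (Θ * (O ^ (k - 1) * (x p.rev * B * (x p * A)))) +
          E (Θ * (O ^ (k - 1) * (x p * x p.rev * Q)))) := by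
    refine (map_expansion E _ _ _ _ _ _ _ _ _).trans ?_
    rw [e0, e1, e2, zero_add, zero_add, zero_add]
  rw [e6]
  generalize E (Θ * (O ^ k * (x p * x p.rev * φ f))) = w3
  generalize E (Θ * (O ^ (k - 1) * (x p * x p.rev * Q))) = w5
  generalize E (Θ * (O ^ (k - 1) * (x p.rev * B * (x p * A)))) = w4 at *
  have e7 : ((k + 1 : ℕ) : ℂ) • w3 + (((k + 1) * k : ℕ) : ℂ) • (w4 + w5) -
      ((k + 1 : ℕ) : ℂ) • (w3 + (k : ℂ) • w5) = (((k + 1) * k : ℕ) : ℂ) • w4 := by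
    push_cast
    module
  rw [e7]
  exact upperIdeal_smul_mem _ e4

end IsTopCoeff

end Recurrence

/-! ### The image of the Pfaffian modulo the left ideal -/

section Miura

variable {n : ℕ}

variable (n) in
/-- The indices `k, …, 2n - 1 - k`. -/
def innerSet (k : ℕ) : Finset (Fin (2 * n)) :=
  Finset.univ.filter fun i => k ≤ i ∧ k ≤ i.rev

theorem mem_innerSet {k : ℕ} {i : Fin (2 * n)} : i ∈ innerSet n k ↔ k ≤ i ∧ k ≤ i.rev := by
  simp [innerSet]

theorem innerSet_zero : innerSet n 0 = Finset.univ := by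
  ext; simp [mem_innerSet]

theorem rev_mem_innerSet {k : ℕ} (a : Fin (2 * n)) (ha : a ∈ innerSet n k) :
    a.rev ∈ innerSet n k := by
  rw [mem_innerSet] at *
  rw [Fin.rev_rev]
  exact ha.symm

theorem innerSet_eq_insert (k : Fin n) :
    innerSet n k = insert (negIdx k) (insert (negIdx k).rev (innerSet n (k + 1))) := by
  ext i
  simp only [Finset.mem_insert, mem_innerSet, Fin.ext_iff, Fin.val_rev, negIdx]
  omega

theorem negIdx_notMem_innerSet (k : Fin n) : negIdx k ∉ innerSet n (k + 1) := by
  simp [mem_innerSet, negIdx]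

theorem negIdx_lt_rev (k : Fin n) (c : Fin (2 * n)) (hc : c ∈ innerSet n (k + 1)) :
    negIdx k < c.rev := by
  rw [mem_innerSet] at hc
  exact Fin.lt_def.2 (Nat.lt_of_succ_le hc.2)

variable (n) in
/-- The operator `μ_i[-1] + ad_τ`. -/
def miuraOp (k : Fin n) : Module.End ℂ (UNeg (cartan n)) :=
  LinearMap.mulLeft ℂ (mu k (-1) (by norm_num)) + adTau (cartan n)

theorem cartanHom_miuraOp (k : Fin n) (p : UNeg (cartan n)) :
    cartanHom (cartan n) (miuraOp n k p) =
      uElt (F (negIdx k) (negIdx k)) (-1) (by norm_num) * cartanHom (cartan n) p +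
        adTau (orth n) (cartanHom (cartan n) p) := by
  have e1 : miuraOp n k p = mu k (-1) (by norm_num) * p + adTau (cartan n) p := rfl
  have e2 : cartanHom (cartan n) (mu k (-1) (by norm_num)) =
      uElt (F (negIdx k) (negIdx k)) (-1) (by norm_num) := cartanHom_uElt _ _ _ _
  rw [e1, map_add (cartanHom (cartan n)), map_mul (cartanHom (cartan n)), e2, cartanHom_adTau]

variable {W : Type*} [Ring W] [Algebra ℂ W] {x : Fin (2 * n) → W}
  {φ : UNeg (orth n) →ₐ[ℂ] W} {E : W →ₗ[ℂ] UNeg (orth n)} {K : Fin (2 * n) → W →ₐ[ℂ] W}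
  {D : W →ₗ[ℂ] W}

theorem sub_smul_mem_of_recurrence {R : Type*} [Ring R] [Algebra ℂ R] {I : Ideal R}
    {τ : R →ₗ[ℂ] R} (hτ : ∀ w ∈ I, τ w ∈ I) {u e f q : R} {c d : ℂ}
    (h1 : u - c • (f * e + τ e) ∈ I) (h2 : e - d • q ∈ I) :
    u - (c * d) • (f * q + τ q) ∈ I := by
  have h3 : c • (f * (e - d • q)) ∈ I := by
    rw [Algebra.smul_def]; exact I.mul_mem_left _ (I.mul_mem_left f h2)
  have h4 : c • τ (e - d • q) ∈ I := by
    rw [Algebra.smul_def]; exact I.mul_mem_left _ (hτ _ h2)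
  have h5 := add_mem h1 (add_mem h3 h4)
  rw [mul_sub, mul_smul_comm, map_sub, map_smul] at h5
  convert h5 using 1
  module

theorem drop_finRange {k : ℕ} (hk : k < n) :
    (List.finRange n).drop k = ⟨k, hk⟩ :: (List.finRange n).drop (k + 1) := by
  rw [List.drop_eq_getElem_cons (by simpa using hk)]
  simp

theorem prod_map_drop_finRange {R : Type*} [Monoid R] (f : Fin n → R) (k : Fin n) :
    (((List.finRange n).drop k).map f).prod =
      f k * (((List.finRange n).drop (k + 1)).map f).prod := by
  rw [drop_finRange k.2, List.map_cons, List.prod_cons]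

/-- Pairs are removed from the outside inwards, so that each `p` precedes all remaining indices. `Q
k` is the product of the last `n - k` operators applied to `1`, and `E (Θ * P k) = 1` fixes the
sign; each step contributes one factor to `m!`. -/
theorem IsTopCoeff.eval_quadForm_innerSet (h : IsTopCoeff x φ E K D) {P : ℕ → W}
    {Q : ℕ → UNeg (orth n)} (hP : ∀ k : Fin n, P k = x (negIdx k) * x (negIdx k).rev * P (k + 1))
    (hPn : P n = 1) (hQ : ∀ k : Fin n, Q k = uElt (F (negIdx k) (negIdx k)) (-1) (by norm_num) *
      Q (k + 1) + adTau (orth n) (Q (k + 1))) (hQn : Q n = 1) (m : ℕ) :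
    ∀ k, k + m = n → ∀ Θ, IsSpectator φ K D (innerSet n k) Θ → E (Θ * P k) = 1 →
      E (Θ * quadForm x φ (innerSet n k) (-1) (by norm_num) ^ m) - (m.factorial : ℂ) • Q k ∈
        upperIdeal n := by
  induction m with
  | zero =>
    intro k hk Θ _ hE
    rw [add_zero] at hk
    rw [hk, hPn, mul_one Θ] at hE
    rw [hk, hQn, pow_zero, mul_one Θ, hE, Nat.factorial_zero, Nat.cast_one, one_smul,
      sub_self (1 : UNeg (orth n))]
    exact zero_mem _
  | succ m ih =>
    intro k hk Θ hΘ hE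
    obtain ⟨k, rfl⟩ : ∃ j : Fin n, (j : ℕ) = k := ⟨⟨k, by omega⟩, rfl⟩
    have hnot' : (negIdx k).rev ∉ innerSet n (k + 1) := fun h' =>
      negIdx_notMem_innerSet k (by simpa using rev_mem_innerSet _ h')
    rw [innerSet_eq_insert] at hΘ ⊢
    rw [hP, ← mul_assoc Θ] at hE
    have h2 := ih (k + 1) (by omega) _ (h.spectator_pair (negIdx_notMem_innerSet k) hnot' hΘ) hE
    have h1 := h.eval_quadForm_insert rev_mem_innerSet (negIdx_notMem_innerSet k) (negIdx_lt_rev k)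
      hΘ m
    rw [hQ, Nat.factorial_succ, Nat.cast_mul (m + 1)]
    generalize E (Θ * (x (negIdx k) * x (negIdx k).rev) *
      quadForm x φ (innerSet n (k + 1)) (-1) (by norm_num) ^ m) = e at h1 h2
    generalize E _ = u at h1 ⊢
    generalize uElt (F (negIdx k) (negIdx k)) (-1) _ = f at h1 ⊢
    exact sub_smul_mem_of_recurrence (fun w hw => adTau_mem_upperIdeal hw) h1 h2

theorem IsTopCoeff.eval_quadForm_univ (h : IsTopCoeff x φ E K D)
    (hE : E (((List.finRange n).map fun i => x (negIdx i) * x (negIdx i).rev).prod) = 1) :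
    E (quadForm x φ Finset.univ (-1) (by norm_num) ^ n) -
      (n.factorial : ℂ) • cartanHom (cartan n) (miuraProduct n) ∈ upperIdeal n := by
  have h1 : IsSpectator φ K D (innerSet n 0) 1 :=
    { comm := fun u => Commute.one_left _
      kill := fun p _ => map_one _
      der := by
        have := h.der_base 1
        rwa [adTau, envDer_one, map_zero, map_one] at this }
  let P : ℕ → W := fun k =>
    (((List.finRange n).drop k).map fun i => x (negIdx i) * x (negIdx i).rev).prod
  let Q : ℕ → UNeg (orth n) := fun k =>
    cartanHom (cartan n) ((((List.finRange n).drop k).map (miuraOp n)).prod 1)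
  have hP : ∀ k : Fin n, P k = x (negIdx k) * x (negIdx k).rev * P (k + 1) :=
    fun k => prod_map_drop_finRange _ k
  have hQ : ∀ k : Fin n, Q k = uElt (F (negIdx k) (negIdx k)) (-1) (by norm_num) *
      Q (k + 1) + adTau (orth n) (Q (k + 1)) := fun k =>
    (congrArg (fun f : Module.End ℂ (UNeg (cartan n)) => cartanHom (cartan n) (f 1))
      (prod_map_drop_finRange (miuraOp n) k)).trans (cartanHom_miuraOp k _)
  have hd : (List.finRange n).drop n = [] := List.drop_of_length_le (by simp)
  have hPn : P n = 1 := by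
    simp only [P]
    rw [hd, List.map_nil, List.prod_nil]
  have hQn : Q n = 1 := by
    simp only [Q]
    rw [hd]
    exact map_one (cartanHom (cartan n))
  have h2 := h.eval_quadForm_innerSet hP hPn hQ hQn n 0 (zero_add n) 1 h1
    ((congrArg E (one_mul _)).trans hE)
  rw [one_mul (quadForm x φ (innerSet n 0) (-1) _ ^ n), innerSet_zero] at h2
  exact h2

end Miura

/-! ### The algebra of Grassmann polynomials with coefficients in an algebra -/

section GrassmannPolynomials

variable (N : ℕ) (U : Type*) [Ring U] [Algebra ℂ U]

/-- Polynomials in the Grassmann variables `ξ_0, …, ξ_{N-1}` with coefficients in `U`. -/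
abbrev GPoly := ExteriorAlgebra ℂ (Fin N → ℂ) ⊗[ℂ] U

/-- The coefficient of `ξ_0 ⋯ ξ_{N-1}` in the exterior algebra. -/
def topForm : ExteriorAlgebra ℂ (Fin N → ℂ) →ₗ[ℂ] ℂ :=
  ExteriorAlgebra.liftAlternating (Pi.single N Matrix.detRowAlternating)

variable {N} in
/-- The substitution `ξ_p ↦ 0` in the exterior algebra. -/
def killForm (p : Fin N) : ExteriorAlgebra ℂ (Fin N → ℂ) →ₐ[ℂ] ExteriorAlgebra ℂ (Fin N → ℂ) :=
  ExteriorAlgebra.map (LinearMap.pi fun i => if i = p then 0 else LinearMap.proj i)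

theorem topForm_ιMulti (v : Fin N → Fin N → ℂ) :
    topForm N (ExteriorAlgebra.ιMulti ℂ N v) = Matrix.det (Matrix.of v) := by
  rw [topForm, ExteriorAlgebra.liftAlternating_apply_ιMulti, Pi.single_eq_same]
  rfl

/-- In degree `N` the top form is a determinant, and the substitution makes its column `p` zero; in
other degrees the form vanishes by definition. -/
theorem topForm_killForm (p : Fin N) (a : ExteriorAlgebra ℂ (Fin N → ℂ)) :
    topForm N (killForm p a) = 0 := by
  have h : topForm N ∘ₗ (killForm p).toLinearMap = 0 := by
    refine ExteriorAlgebra.lhom_ext fun i => ?_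
    ext v
    simp only [LinearMap.compAlternatingMap_apply, LinearMap.comp_apply, AlgHom.toLinearMap_apply,
      LinearMap.zero_apply]
    rw [killForm, ExteriorAlgebra.map_apply_ιMulti]
    rcases eq_or_ne i N with rfl | hi
    · rw [topForm_ιMulti]
      exact Matrix.det_eq_zero_of_column_eq_zero p fun j => by simp
    · rw [topForm, ExteriorAlgebra.liftAlternating_apply_ιMulti, Pi.single_eq_of_ne hi]
      rfl
  exact DFunLike.congr_fun h a

variable {N U}

/-- The variable `ξ_i`. -/
def gVar (i : Fin N) : GPoly N U := ExteriorAlgebra.ι ℂ (Pi.single i 1) ⊗ₜ 1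

variable (N U) in
/-- The inclusion of the coefficients. -/
def gConst : U →ₐ[ℂ] GPoly N U := Algebra.TensorProduct.includeRight

variable (N U) in
/-- The coefficient of `ξ_0 ⋯ ξ_{N-1}`. -/
def gTop : GPoly N U →ₗ[ℂ] U :=
  (TensorProduct.lid ℂ U).toLinearMap ∘ₗ LinearMap.rTensor U (topForm N)

variable (U) in
/-- The substitution `ξ_p ↦ 0`. -/
def gKill (p : Fin N) : GPoly N U →ₐ[ℂ] GPoly N U :=
  Algebra.TensorProduct.map (killForm p) (AlgHom.id ℂ U)

variable (N) in
/-- The application of a linear map to the coefficients. -/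
def gMap (δ : U →ₗ[ℂ] U) : GPoly N U →ₗ[ℂ] GPoly N U :=
  LinearMap.lTensor _ δ

theorem gTop_tmul (a : ExteriorAlgebra ℂ (Fin N → ℂ)) (u : U) :
    gTop N U (a ⊗ₜ u) = topForm N a • u := rfl

theorem gVar_anti (i j : Fin N) : (gVar i * gVar j : GPoly N U) = -(gVar j * gVar i) := by
  rw [gVar, gVar, Algebra.TensorProduct.tmul_mul_tmul, Algebra.TensorProduct.tmul_mul_tmul,
    eq_neg_iff_add_eq_zero, ← TensorProduct.add_tmul, ExteriorAlgebra.ι_add_mul_swap,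
    TensorProduct.zero_tmul]

theorem gVar_comm (i : Fin N) (u : U) : Commute (gVar i) (gConst N U u) := by
  rw [commute_iff_eq, gVar, gConst, Algebra.TensorProduct.includeRight_apply]
  simp

theorem gTop_left (u : U) (w : GPoly N U) : gTop N U (gConst N U u * w) = u * gTop N U w := by
  rw [gConst, Algebra.TensorProduct.includeRight_apply]
  induction w using TensorProduct.induction_on with
  | zero => simp
  | tmul a v => simp [gTop_tmul]
  | add v w hv hw => rw [mul_add, map_add, map_add, mul_add, hv, hw]

theorem gTop_right (u : U) (w : GPoly N U) : gTop N U (w * gConst N U u) = gTop N U w * u := by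
  rw [gConst, Algebra.TensorProduct.includeRight_apply]
  induction w using TensorProduct.induction_on with
  | zero => simp
  | tmul a v => simp [gTop_tmul]
  | add v w hv hw => rw [add_mul, map_add, map_add, add_mul, hv, hw]

theorem gKill_gConst (p : Fin N) (u : U) : gKill U p (gConst N U u) = gConst N U u := by
  simp [gKill, gConst]

theorem gKill_gVar {p i : Fin N} (h : i ≠ p) : gKill U p (gVar i) = gVar i := by
  have e : (LinearMap.pi fun j => if j = p then 0 else LinearMap.proj j :
      (Fin N → ℂ) →ₗ[ℂ] (Fin N → ℂ)) (Pi.single i 1) = Pi.single i 1 := by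
    ext j
    rw [LinearMap.pi_apply]
    split_ifs with hj
    · rw [hj, LinearMap.zero_apply, Pi.single_eq_of_ne h.symm]
    · rfl
  rw [gKill, gVar, Algebra.TensorProduct.map_tmul, killForm, ExteriorAlgebra.map_apply_ι, e]
  rfl

theorem gTop_gKill (p : Fin N) (w : GPoly N U) : gTop N U (gKill U p w) = 0 := by
  induction w using TensorProduct.induction_on with
  | zero => simp
  | tmul a v => rw [gKill, Algebra.TensorProduct.map_tmul, gTop_tmul, topForm_killForm, zero_smul]
  | add v w hv hw => rw [map_add, map_add, hv, hw, add_zero]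

theorem gMap_mul {δ : U →ₗ[ℂ] U} (hδ : ∀ a b, δ (a * b) = a * δ b + δ a * b) (v w : GPoly N U) :
    gMap N δ (v * w) = v * gMap N δ w + gMap N δ v * w := by
  induction v using TensorProduct.induction_on with
  | zero => simp
  | add v v' hv hv' => rw [add_mul, map_add, map_add, add_mul, add_mul, hv, hv']; abel
  | tmul a u =>
    induction w using TensorProduct.induction_on with
    | zero => simp
    | add w w' hw hw' => rw [mul_add, map_add, map_add, mul_add, mul_add, hw, hw']; abel
    | tmul b u' => simp [gMap, hδ, TensorProduct.tmul_add]

theorem gMap_gVar {δ : U →ₗ[ℂ] U} (h1 : δ 1 = 0) (i : Fin N) : gMap N δ (gVar i) = 0 := by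
  simp [gMap, gVar, h1]

theorem gMap_gConst (δ : U →ₗ[ℂ] U) (u : U) :
    gMap N δ (gConst N U u) = gConst N U (δ u) := by
  simp [gMap, gConst]

theorem gTop_gMap (δ : U →ₗ[ℂ] U) (w : GPoly N U) : gTop N U (gMap N δ w) = δ (gTop N U w) := by
  induction w using TensorProduct.induction_on with
  | zero => simp
  | tmul a v => simp [gMap, gTop_tmul]
  | add v w hv hw => rw [map_add, map_add, map_add, map_add, hv, hw]

theorem gTop_prod_gVar (i : Fin N → Fin N) :
    gTop N U (List.ofFn fun k => gVar (i k)).prod =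
      (Matrix.of fun k => Pi.single (i k) (1 : ℂ)).det • 1 := by
  have e : (List.ofFn fun k => (gVar (i k) : GPoly N U)).prod =
      ExteriorAlgebra.ιMulti ℂ N (fun k => Pi.single (i k) (1 : ℂ)) ⊗ₜ 1 := by
    rw [ExteriorAlgebra.ιMulti_apply]
    change _ = Algebra.TensorProduct.includeLeft (R := ℂ) (S := ℂ) (B := U) _
    rw [map_list_prod, List.map_ofFn]
    rfl
  rw [e, gTop_tmul, topForm_ιMulti]

end GrassmannPolynomials

/-- The concrete model in which the recurrence is applied: `ad_τ` acts on the coefficients only and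
leaves the Grassmann variables constant. -/
theorem isTopCoeff_gPoly (n : ℕ) :
    IsTopCoeff (gVar : Fin (2 * n) → GPoly (2 * n) (UNeg (orth n))) (gConst _ _) (gTop _ _)
      (gKill _) (gMap _ (adTau (orth n))) where
  anti := gVar_anti
  comm := gVar_comm
  left := gTop_left
  right := gTop_right
  kill_base := gKill_gConst
  kill_var _ _ h := gKill_gVar h
  kill := gTop_gKill
  der_mul := gMap_mul (adTau_mul)
  der_var := gMap_gVar (envDer_one _)
  der_base := gMap_gConst _
  der := gTop_gMap _

/-! ### The Pfaffian as a top coefficient -/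

section ListProducts

theorem prod_map_finRange {R : Type*} [Monoid R] {n : ℕ} (y : ℕ → R) :
    ((List.finRange n).map fun k : Fin n => y k).prod = ((List.range n).map y).prod := by
  rw [← List.map_coe_finRange_eq_range, List.map_map]
  rfl

theorem prod_pairs {R : Type*} [Monoid R] (n : ℕ) (y : ℕ → R) :
    ((List.finRange n).map fun k : Fin n => y (2 * k) * y (2 * k + 1)).prod =
      ((List.finRange (2 * n)).map fun k : Fin (2 * n) => y k).prod := by
  rw [prod_map_finRange fun k => y (2 * k) * y (2 * k + 1), prod_map_finRange]
  induction n with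
  | zero => rfl
  | succ n ih =>
    rw [List.range_succ, show 2 * (n + 1) = 2 * n + 1 + 1 by ring, List.range_succ, List.range_succ]
    simp [ih]

theorem prod_pairs_fin {R : Type*} [Monoid R] {n : ℕ} (y : Fin (2 * n) → R) :
    ((List.finRange n).map fun k : Fin n =>
      y ⟨2 * k, by omega⟩ * y ⟨2 * k + 1, by omega⟩).prod = (List.ofFn y).prod := by
  have h := prod_pairs n fun k => if hk : k < 2 * n then y ⟨k, hk⟩ else 1
  rw [List.ofFn_eq_map]
  convert h using 3
  · ext k
    rw [dif_pos (by omega), dif_pos (by omega)]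
  · ext k
    rw [dif_pos k.2]

/-- Pairs are even, so each `x_{-p}` moves without sign past the pairs nested inside `x_p, x_{-p}`,
and the product becomes the one in increasing order. -/
theorem prod_rev_pairs {R : Type*} [Monoid R] {n : ℕ} (x : Fin (2 * n) → R)
    (hx : ∀ i j k, Commute (x i) (x j * x k)) :
    ((List.finRange n).map fun i => x (negIdx i) * x (negIdx i).rev).prod =
      (List.ofFn x).prod := by
  let y : ℕ → R := fun k => if hk : k < 2 * n then x ⟨k, hk⟩ else 1
  have hy : ∀ k : Fin (2 * n), y k = x k := fun k => dif_pos k.2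
  have key : ∀ m k, k + m = n →
      (((List.finRange n).drop k).map fun i => x (negIdx i) * x (negIdx i).rev).prod =
        ((List.range' k (2 * m)).map y).prod := by
    intro m
    induction m with
    | zero =>
      intro k hk
      rw [List.drop_of_length_le (by simp [← hk])]
      rfl
    | succ m ih =>
      intro k hk
      obtain ⟨k, rfl⟩ : ∃ j : Fin n, (j : ℕ) = k := ⟨⟨k, by omega⟩, rfl⟩
      have h1 : y k = x (negIdx k) := hy (negIdx k)
      have h2 : y (k + 1 + 2 * m) = x (negIdx k).rev := by
        rw [← hy]
        congr 1
        simp only [Fin.val_rev, negIdx]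
        omega
      have hc : Commute (x (negIdx k).rev) (((List.finRange n).drop (k + 1)).map fun i =>
          x (negIdx i) * x (negIdx i).rev).prod := by
        refine Commute.list_prod_right _ _ fun w hw => ?_
        obtain ⟨i, -, rfl⟩ := List.mem_map.1 hw
        exact hx _ _ _
      rw [prod_map_drop_finRange, show 2 * (m + 1) = 2 * m + 1 + 1 by ring, List.range'_succ,
        List.range'_1_concat, List.map_cons, List.prod_cons, List.map_append, List.prod_append,
        ← ih (k + 1) (by omega), List.map_singleton, List.prod_singleton, h1, h2, mul_assoc, hc.eq]
  have h := key n 0 (zero_add n)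
  rw [List.drop_zero, ← List.range_eq_range', ← prod_map_finRange] at h
  rw [h, List.ofFn_eq_map]
  simp only [hy]

theorem prod_mul_of_commute {R ι : Type*} [Monoid R] (p q : ι → R)
    (h : ∀ i j, Commute (p i) (q j)) (l : List ι) :
    (l.map fun k => p k * q k).prod = (l.map p).prod * (l.map q).prod := by
  induction l with
  | nil => simp
  | cons a l ih =>
    have hc : Commute (l.map p).prod (q a) := by
      clear ih
      induction l with
      | nil => exact Commute.one_left _
      | cons b l ih => rw [List.map_cons, List.prod_cons]; exact (h b a).mul_left ih
    rw [List.map_cons, List.prod_cons, ih, List.map_cons, List.prod_cons, List.map_cons,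
      List.prod_cons, mul_assoc, mul_assoc, ← mul_assoc (q a), ← hc.eq, mul_assoc]

end ListProducts

/-! ### Top coefficients of powers of quadratic forms. -/

section TopCoefficient

variable {n : ℕ} {U : Type*} [Ring U] [Algebra ℂ U]

theorem gTop_prod_pairs (i : Fin (2 * n) → Fin (2 * n)) (u : U) :
    gTop (2 * n) U (((List.finRange n).map fun k : Fin n =>
      gVar (i ⟨2 * k, by omega⟩) * gVar (i ⟨2 * k + 1, by omega⟩)).prod * gConst _ _ u) =
      (Matrix.of fun k => Pi.single (i k) (1 : ℂ)).det • u := by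
  rw [gTop_right, prod_pairs_fin fun k => gVar (i k), gTop_prod_gVar, smul_mul_assoc, one_mul]

theorem det_single_perm {N : ℕ} (σ : Equiv.Perm (Fin N)) :
    (Matrix.of fun k => Pi.single (σ k) (1 : ℂ)).det = ((Equiv.Perm.sign σ : ℤ) : ℂ) := by
  have e : (Matrix.of fun k => Pi.single (σ k) (1 : ℂ)) =
      (1 : Matrix (Fin N) (Fin N) ℂ).submatrix σ id := by
    ext i j
    simp [Matrix.one_apply, Pi.single_apply, eq_comm]
  rw [e, Matrix.det_permute, Matrix.det_one, mul_one]

/-- Expand the power over all sequences of `n` index pairs. The Grassmann factor contributes the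
determinant of the concatenated index sequence: zero for a repetition, the sign for a permutation.
The coefficients keep their order. -/
theorem gTop_pow (t : Fin (2 * n) × Fin (2 * n) → U) :
    gTop (2 * n) U ((∑ q : Fin (2 * n) × Fin (2 * n),
      gVar q.1 * gVar q.2 * gConst (2 * n) U (t q)) ^ n) =
    ∑ σ : Equiv.Perm (Fin (2 * n)), ((Equiv.Perm.sign σ : ℤ) : ℂ) •
      ((List.finRange n).map fun k : Fin n =>
        t (σ ⟨2 * k, by omega⟩, σ ⟨2 * k + 1, by omega⟩)).prod := by
  have hmul := (MultilinearMap.mkPiAlgebraFin ℂ n (GPoly (2 * n) U)).map_sum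
    (g := fun _ (q : Fin (2 * n) × Fin (2 * n)) => gVar q.1 * gVar q.2 * gConst (2 * n) U (t q))
  simp only [MultilinearMap.mkPiAlgebraFin_apply, List.ofFn_const, List.prod_replicate] at hmul
  rw [hmul, map_sum]
  have key : ∀ f : Fin n → Fin (2 * n) × Fin (2 * n), gTop (2 * n) U
      (List.ofFn fun k => gVar (f k).1 * gVar (f k).2 * gConst (2 * n) U (t (f k))).prod =
      gTop (2 * n) U (((List.finRange n).map fun k => gVar (f k).1 * gVar (f k).2).prod *
        gConst _ _ ((List.finRange n).map fun k => t (f k)).prod) := by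
    intro f
    rw [List.ofFn_eq_map, prod_mul_of_commute (fun k => gVar (f k).1 * gVar (f k).2)
      (fun k => gConst (2 * n) U (t (f k)))
      (fun i j => (gVar_comm _ _).mul_left (gVar_comm _ _)), map_list_prod, List.map_map]
    rfl
  symm
  refine Finset.sum_of_injOn (fun σ k => (σ ⟨2 * k, by omega⟩, σ ⟨2 * k + 1, by omega⟩))
    ?_ (by simp) ?_ ?_
  · intro σ _ τ _ h
    ext j
    -- The value of `σ` at `j` is read off from pair number `j / 2`, the parity of `j` selecting the
    -- component.
    have hj := congrFun h ⟨j / 2, by omega⟩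
    rw [Prod.mk.injEq] at hj
    rcases Nat.mod_two_eq_zero_or_one j with h0 | h0
    · convert congrArg Fin.val hj.1 using 4 <;> simp only [] <;> omega
    · convert congrArg Fin.val hj.2 using 4 <;> simp only [] <;> omega
  · intro f _ hf
    let i : Fin (2 * n) → Fin (2 * n) := fun j =>
      if (j : ℕ) % 2 = 0 then (f ⟨j / 2, by omega⟩).1 else (f ⟨j / 2, by omega⟩).2
    have h1 : ∀ k : Fin n, i ⟨2 * k, by omega⟩ = (f k).1 := fun k => by
      simp [i]
    have h2 : ∀ k : Fin n, i ⟨2 * k + 1, by omega⟩ = (f k).2 := fun k => by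
      have e : (⟨(2 * (k : ℕ) + 1) / 2, by omega⟩ : Fin n) = k := Fin.ext (by simp only []; omega)
      simp only [i]
      rw [if_neg (by omega), e]
    rw [key]
    simp only [← h1, ← h2]
    rw [gTop_prod_pairs]
    by_cases hi : Function.Injective i
    · refine absurd ⟨Equiv.ofBijective i (Finite.injective_iff_bijective.1 hi), by simp, ?_⟩ hf
      funext k
      exact Prod.ext (h1 k) (h2 k)
    · obtain ⟨a, b, hab, hne⟩ := Function.not_injective_iff.1 hi
      rw [Matrix.det_zero_of_row_eq hne (congrArg (Pi.single · (1 : ℂ)) hab), zero_smul]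
  · intro σ _
    rw [key]
    exact ((gTop_prod_pairs σ _).trans (by rw [det_single_perm])).symm

theorem gTop_prod_rev_pairs :
    gTop (2 * n) U ((List.finRange n).map fun i => gVar (negIdx i) * gVar (negIdx i).rev).prod =
      1 := by
  rw [prod_rev_pairs gVar fun i j k => ?_]
  · refine (gTop_prod_gVar id).trans ?_
    have e : (Matrix.of fun k : Fin (2 * n) => Pi.single (id k) (1 : ℂ)) = 1 := by
      ext i j
      simp [Matrix.one_apply, Pi.single_apply, eq_comm]
    rw [e, Matrix.det_one, one_smul]
  · rw [commute_iff_eq, ← mul_assoc, gVar_anti i j, neg_mul, mul_assoc, gVar_anti i k, mul_neg,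
      neg_neg, mul_assoc]

theorem gTop_smul_pow (c : ℂ) (t : Fin (2 * n) × Fin (2 * n) → U) :
    gTop (2 * n) U ((c • ∑ q : Fin (2 * n) × Fin (2 * n),
      gVar q.1 * gVar q.2 * gConst (2 * n) U (t q)) ^ n) =
    c ^ n • ∑ σ : Equiv.Perm (Fin (2 * n)), ((Equiv.Perm.sign σ : ℤ) : ℂ) •
      ((List.finRange n).map fun k : Fin n =>
        t (σ ⟨2 * k, by omega⟩, σ ⟨2 * k + 1, by omega⟩)).prod := by
  rw [smul_pow, map_smul, gTop_pow]

theorem factorial_smul_inv_smul {V : Type*} [AddCommGroup V] [Module ℂ V] (n : ℕ) (v : V) :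
    (n.factorial : ℂ) • ((2 : ℂ) ^ n * (n.factorial : ℂ))⁻¹ • v = (2⁻¹ : ℂ) ^ n • v := by
  rw [smul_smul, mul_inv, mul_left_comm,
    mul_inv_cancel₀ (Nat.cast_ne_zero.2 n.factorial_ne_zero), mul_one, inv_pow]

theorem quadForm_univ {W : Type*} [Ring W] [Algebra ℂ W] (x : Fin (2 * n) → W)
    (φ : UNeg (orth n) →ₐ[ℂ] W) : quadForm x φ Finset.univ (-1) (by norm_num) =
      (2⁻¹ : ℂ) • ∑ q : Fin (2 * n) × Fin (2 * n), x q.1 * x q.2 * φ (tildeF n q.1 q.2) := by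
  rw [quadForm, Fintype.sum_prod_type]
  congr 1
  refine Finset.sum_congr rfl fun a _ => ?_
  rw [linForm, Finset.mul_sum]
  refine Finset.sum_congr rfl fun b _ => ?_
  rw [tildeF_eq]
  exact (mul_assoc _ _ _).symm

/-- The `n` factors ½ of the quadratic form match the `2⁻ⁿ` of the Pfaffian, which leaves its `1 /
n!` to be cleared. -/
theorem factorial_smul_pfaffian (n : ℕ) :
    (n.factorial : ℂ) • pfaffian n = gTop (2 * n) (UNeg (orth n))
      (quadForm gVar (gConst _ _) Finset.univ (-1) (by norm_num) ^ n) := by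
  rw [quadForm_univ gVar (gConst (2 * n) (UNeg (orth n)))]
  exact (factorial_smul_inv_smul n _).trans
    (gTop_smul_pow 2⁻¹ fun q : Fin (2 * n) × Fin (2 * n) => tildeF n q.1 q.2).symm

end TopCoefficient

/-! ### The Pfaffian is an invariant -/

section Invariance

theorem sum_pairs_fin {n : ℕ} (y : Fin (2 * n) → ℂ) :
    ((List.finRange n).map fun k : Fin n =>
      y ⟨2 * k, by omega⟩ + y ⟨2 * k + 1, by omega⟩).sum = ∑ k, y k := by
  rw [← List.sum_ofFn]
  -- The additive statement is the product lemma read in `Multiplicative ℂ`.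
  exact prod_pairs_fin (R := Multiplicative ℂ) y

theorem derivation_list_prod {A ι : Type*} [Ring A] [Algebra ℂ A] {D : A →ₗ[ℂ] A}
    (hD : ∀ a b, D (a * b) = a * D b + D a * b) (h1 : D 1 = 0) {t : ι → A} {w : ι → ℂ}
    (ht : ∀ i, D (t i) = w i • t i) (l : List ι) :
    D (l.map t).prod = (l.map w).sum • (l.map t).prod := by
  induction l with
  | nil => simp [h1]
  | cons a l ih =>
    rw [List.map_cons, List.prod_cons, hD, ih, ht, List.map_cons, List.sum_cons, mul_smul_comm,
      smul_mul_assoc, add_smul, add_comm]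

theorem sum_eq_zero_of_rev {N : ℕ} {c : Fin N → ℂ} (hc : ∀ i, c i.rev = -c i) :
    ∑ i, c i = 0 := by
  have h := Equiv.sum_comp Fin.revPerm c
  simp only [Fin.revPerm_apply, hc, Finset.sum_neg_distrib] at h
  exact self_eq_neg.1 h.symm

variable (n : ℕ)

theorem envDer_constDer_tildeF {y : orth n} {c : Fin (2 * n) → ℂ}
    (hy : (y : Matrix (Fin (2 * n)) (Fin (2 * n)) ℂ) = Matrix.diagonal c)
    (hc : ∀ i, c i.rev = -c i) (i j : Fin (2 * n)) :
    envDer (constDer y) (tildeF n i j) = (c i + c j) • tildeF n i j := by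
  rw [tildeF_eq, envDer_constDer_uElt, lie_diagonal_F hy, hc, sub_neg_eq_add, uElt_smul]

/-- Every monomial uses each index once, so its weight is the sum of all `c i`, which vanishes
because `c` is odd under `Fin.rev`. -/
theorem pfaffian_mem_invariants : pfaffian n ∈ invariants (cartan n) := by
  intro y hy
  obtain ⟨c, hyc⟩ := cartan_diagonal hy
  have hc : ∀ i, c i.rev = -c i := fun i => by
    have := orth_apply_rev y i i
    rwa [hyc, Matrix.diagonal_apply_eq, Matrix.diagonal_apply_eq] at this
  have key : ∀ σ : Equiv.Perm (Fin (2 * n)), envDer (constDer y)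
      ((List.finRange n).map fun k : Fin n =>
        tildeF n (σ ⟨2 * k, by omega⟩) (σ ⟨2 * k + 1, by omega⟩)).prod = 0 := fun σ => by
    refine (derivation_list_prod (envDer_mul (constDer y)) (envDer_one _)
      (fun k => envDer_constDer_tildeF n hyc hc _ _) _).trans ?_
    rw [sum_pairs_fin fun k => c (σ k), Equiv.sum_comp σ c, sum_eq_zero_of_rev hc, zero_smul]
  rw [pfaffian, map_smul, map_sum, Finset.sum_eq_zero, smul_zero]
  intro σ _
  rw [map_smul, key, smul_zero]

theorem pfaffian_sub_mem_upperIdeal :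
    pfaffian n - cartanHom (cartan n) (miuraProduct n) ∈ upperIdeal n := by
  have h := (isTopCoeff_gPoly n).eval_quadForm_univ gTop_prod_rev_pairs
  rw [← factorial_smul_pfaffian] at h
  generalize pfaffian n = u at *
  generalize cartanHom (cartan n) (miuraProduct n) = v at *
  have h2 := upperIdeal_smul_mem (n.factorial : ℂ)⁻¹ h
  rwa [← smul_sub, inv_smul_smul₀ (Nat.cast_ne_zero.2 n.factorial_ne_zero)] at h2

end Invariance

end AffinePfaffian

end

theorem mainTheorem3 (n : ℕ) :
    (∃! χ : AffinePfaffian.invariants (AffinePfaffian.cartan n) →ₐ[ℂ]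
        AffinePfaffian.UNeg (AffinePfaffian.cartan n),
      AffinePfaffian.IsHarishChandra (AffinePfaffian.cartan n) (AffinePfaffian.upperIdeal n) χ) ∧
    ∃ hPf : AffinePfaffian.pfaffian n ∈ AffinePfaffian.invariants (AffinePfaffian.cartan n),
      ∀ χ : AffinePfaffian.invariants (AffinePfaffian.cartan n) →ₐ[ℂ]
          AffinePfaffian.UNeg (AffinePfaffian.cartan n),
        AffinePfaffian.IsHarishChandra (AffinePfaffian.cartan n) (AffinePfaffian.upperIdeal n) χ →
        χ ⟨AffinePfaffian.pfaffian n, hPf⟩ = AffinePfaffian.miuraProduct n := by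
  exact ⟨AffinePfaffian.existsUnique_isHarishChandra n, AffinePfaffian.pfaffian_mem_invariants n,
    fun _ hχ => hχ.apply_eq (AffinePfaffian.pfaffian_sub_mem_upperIdeal n)⟩
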